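/- For $n\ge 2$ consider the random graph model with latent vector $(\xi_1,\dots,\xi_n)\sim\mathbb P_\xi$, where $\mathbb P_\xi$ is an arbitrary probability distribution on $[0,1]^n$, and with $$\theta_{ij}=f(\xi_i,\xi_j)\quad(i\ne j),\qquad \theta_{ii}=0 .$$ Given $\xi$, the entries $A_{ij}\sim\mathrm{Bernoulli}(\theta_{ij})$, $1\le j<i\le n$, are independent; $A_{ji}=A_{ij}$ and $A_{ii}=0$. Only the adjacency matrix $A=(A_{ij})$ is observed. Let $\alpha>0$, $M>0$, let $\lfloor\alpha\rfloor$ be the largest integer not exceeding $\alpha$, and let $\mathcal D=\{(x,y)\in[0,1]^2:x\ge y\}$. Let $\mathcal F_\alpha(M)$ be the class of all symmetric functions $f:[0,1]^2\to[0,1]$ that are $\lfloor\alpha\rfloor$ times differentiable on $\mathcal D$ and satisfy $\|f\|_{\mathcal H_\alpha}\le M$, where, with $\nabla_{jk}f=\partial^{j+k}f/(\partial x)^j(\partial y)^k$ and $\nabla_{00}f=f$, $$\|f\|_{\mathcal H_\alpha}=\max_{j+k\le\lfloor\alpha\rfloor}\ \sup_{(x,y)\in\mathcal D}|\nabla_{jk}f(x,y)|+\max_{j+k=\lfloor\alpha\rfloor}\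 \sup_{(x,y)\ne(x',y')\in\mathcal D}\frac{|\nabla_{jk}f(x,y)-\nabla_{jk}f(x',y')|}{(|x-x'|+|y-y'|)^{\alpha-\lfloor\alpha\rfloor}} .$$ **Theorem.** For all $\alpha>0$ and $M>0$ there is a constant $C>0$, independent of $n$, such that for all $n\ge2$ $$C^{-1}r_n\ \le\ \inf_{\hat\theta}\ \sup_{f\in\mathcal F_\alpha(M)}\ \sup_{\mathbb P_\xi}\ \mathbb E\Big\{\frac1{n^2}\sum_{i,j=1}^n(\hat\theta_{ij}-\theta_{ij})^2\Big\}\ \le\ C\,r_n,\qquad r_n=\begin{cases}n^{-\frac{2\alpha}{\alpha+1}},&0<\alpha<1,\\[3pt] \dfrac{\log n}{n},&\alpha\ge1.\end{cases}$$ Here the infimum is over all estimators $\hat\theta=\hat\theta(A)\in\mathbb R^{n\times n}$, the second supremum is over all probability distributions $\mathbb P_\xi$ on $[0,1]^n$, and the expectation is taken jointly over $\xi$ and $A$. -/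

import Mathlib

open MeasureTheory ProbabilityTheory
open scoped ENNReal

namespace Graphon

noncomputable section

/-- The closed triangle `{(x, y) ∈ [0,1]² : x ≥ y}`. -/
def triangle : Set (ℝ × ℝ) := {p | 0 ≤ p.2 ∧ p.2 ≤ p.1 ∧ p.1 ≤ 1}

/-- The mixed partial derivative `∂^(j+k) f / (∂x)^j (∂y)^k` at a point `p` of the closed triangle.
It is the `(j+k)`-th derivative of `f` relative to the triangle (a convex set with nonempty
interior, so that this derivative is unique), applied to `j` copies of `e₁ = (1,0)` and `k` copies
of `e₂ = (0,1)`. For `j = k = 0` it is `f p`. -/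
def partialDeriv (j k : ℕ) (f : ℝ × ℝ → ℝ) (p : ℝ × ℝ) : ℝ :=
  iteratedFDerivWithin ℝ (j + k) f triangle p
    (fun i => if (i : ℕ) < j then ((1 : ℝ), (0 : ℝ)) else ((0 : ℝ), (1 : ℝ)))

/-- `f` is `m` times differentiable on the closed triangle. -/
def TimesDifferentiable (m : ℕ) (f : ℝ × ℝ → ℝ) : Prop :=
  ∀ i < m, DifferentiableOn ℝ (iteratedFDerivWithin ℝ i f triangle) triangle

/-- The Hölder norm of order `α` on the triangle, with values in `[0, ∞]`: the maximum over
`j + k ≤ ⌊α⌋` of the sup norm of `∂_x^j ∂_y^k f`, plus the maximum over `j + k = ⌊α⌋` of the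
Hölder quotient of order `α - ⌊α⌋` of `∂_x^j ∂_y^k f` with respect to the `ℓ₁` distance. -/
def holderNorm (α : ℝ) (f : ℝ × ℝ → ℝ) : ℝ≥0∞ :=
  (⨆ (j : ℕ) (k : ℕ) (_ : j + k ≤ ⌊α⌋₊) (p ∈ triangle), ENNReal.ofReal |partialDeriv j k f p|) +
  ⨆ (j : ℕ) (k : ℕ) (_ : j + k = ⌊α⌋₊) (p ∈ triangle) (q ∈ triangle) (_ : p ≠ q),
    ENNReal.ofReal
      (|partialDeriv j k f p - partialDeriv j k f q| /
        (|p.1 - q.1| + |p.2 - q.2|) ^ (α - (⌊α⌋₊ : ℝ)))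

/-- The Hölder class `H_α(M)` of symmetric functions on `[0,1]²` (only the values of `f` on
`[0,1]²` matter). -/
def holderClass (α M : ℝ) : Set (ℝ × ℝ → ℝ) :=
  {f | TimesDifferentiable ⌊α⌋₊ f ∧ holderNorm α f ≤ ENNReal.ofReal M ∧
    ∀ x ∈ Set.Icc (0 : ℝ) 1, ∀ y ∈ Set.Icc (0 : ℝ) 1, f (x, y) = f (y, x)}

/-- The class `F_α(M)` of graphons: the members of `H_α(M)` with values in `[0,1]` on `[0,1]²`. -/
def graphonClass (α M : ℝ) : Set (ℝ × ℝ → ℝ) :=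
  {f | f ∈ holderClass α M ∧
    ∀ x ∈ Set.Icc (0 : ℝ) 1, ∀ y ∈ Set.Icc (0 : ℝ) 1, f (x, y) ∈ Set.Icc (0 : ℝ) 1}

/-- The matrix `θ_ij = f(ξ_i, ξ_j)` for `i ≠ j`, and `θ_ii = 0`. -/
def theta {n : ℕ} (f : ℝ × ℝ → ℝ) (ξ : Fin n → unitInterval) : Matrix (Fin n) (Fin n) ℝ :=
  fun i j => if i = j then 0 else f ((ξ i : ℝ), (ξ j : ℝ))

/-- The pairs `(i, j)` with `j < i`, i.e. the potential edges of a graph on `n` nodes. -/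
abbrev EdgeSlot (n : ℕ) : Type := {p : Fin n × Fin n // p.2 < p.1}

/-- The symmetric adjacency matrix with zero diagonal and the given entries below the diagonal. -/
def adjacency {n : ℕ} (e : EdgeSlot n → Bool) : Matrix (Fin n) (Fin n) Bool :=
  fun i j =>
    if h : j < i then e ⟨(i, j), h⟩
    else if h' : i < j then e ⟨(j, i), h'⟩
    else false

/-- The conditional law, given the matrix `θ` (with values in `[0,1]`), of the entries `A_ij`,
`j < i`: they are independent and `A_ij ∼ Bernoulli(θ_ij)`. The projection onto `[0,1]` is the
identity on the values in question. -/
def edgeLaw {n : ℕ} (θ : Matrix (Fin n) (Fin n) ℝ) : Measure (EdgeSlot n → Bool) :=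
  Measure.pi fun e =>
    bernoulliMeasure true false (Set.projIcc (0 : ℝ) 1 zero_le_one (θ e.1.1 e.1.2))

/-- The normalized squared Frobenius loss `n⁻² ∑_{i,j} (η_ij - θ_ij)²`. -/
def loss {n : ℕ} (η θ : Matrix (Fin n) (Fin n) ℝ) : ℝ :=
  (1 / (n : ℝ) ^ 2) * ∑ i, ∑ j, (η i j - θ i j) ^ 2

/-- An estimator is an arbitrary map from adjacency matrices to real `n × n` matrices (it is
automatically measurable, because there are finitely many adjacency matrices). -/
abbrev Estimator (n : ℕ) : Type := Matrix (Fin n) (Fin n) Bool → Matrix (Fin n) (Fin n) ℝ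

/-- The risk `E[n⁻² ∑_{i,j} (θ̂_ij - θ_ij)²]`, jointly over `(ξ_1, …, ξ_n) ∼ P` and over the
adjacency matrix `A` given `ξ`. -/
def risk {n : ℕ} (est : Estimator n) (f : ℝ × ℝ → ℝ)
    (P : ProbabilityMeasure (Fin n → unitInterval)) : ℝ≥0∞ :=
  ∫⁻ ξ, ∫⁻ e, ENNReal.ofReal (loss (est (adjacency e)) (theta f ξ)) ∂(edgeLaw (theta f ξ))
    ∂(P : Measure (Fin n → unitInterval))

/-- The minimax risk over the graphons in `F_α(M)` and over all laws of the latent vector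
`(ξ_1, …, ξ_n)` on `[0,1]^n` (no independence or identical distribution is assumed). -/
def minimaxRisk (n : ℕ) (α M : ℝ) : ℝ≥0∞ :=
  ⨅ est : Estimator n, ⨆ f ∈ graphonClass α M,
    ⨆ P : ProbabilityMeasure (Fin n → unitInterval), risk est f P

/-- The rate `n^(-2α/(α+1))` for `0 < α < 1` and `(log n)/n` for `α ≥ 1`. -/
def rate (α : ℝ) (n : ℕ) : ℝ :=
  if α < 1 then (n : ℝ) ^ (-(2 * α / (α + 1))) else Real.log n / n

end

end Graphon

namespace Graphon

noncomputable section

/-! Since the law of `ξ` is arbitrary, point masses turn the latent vector into one more adversarial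
parameter, while a bound uniform in `(f, ξ)` controls every mixture. The problem becomes that of
estimating the means `f (ξ_i, ξ_j)`, `j < i`, of independent Bernoulli entries; `minimaxRisk_le` and
`le_minimaxRisk` make this reduction.

Upper bound. With `β = min α 1`, `f` is `β`-Hölder on the square, so moving each `ξ_i` to a grid of
mesh `1/k` and rounding the `k × k` values to multiples of `δ = k^(-β)` costs `O(δ)`. Least squares
over the resulting finite net has risk of order `δ² + log (cardinality) / n²`
(`sum_weight_mul_sq_le`). Assigning nodes to blocks contributes `n log k` to the log-cardinality.
The block values contribute only `O(k²)`, with no extra logarithm, because neighbouring values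
differ by boundedly many multiples of `δ` and the net records increments (`exists_blockLevel_eq`).
Thus the risk is at most of order `k^(-2β) + k²/n² + (log k)/n`, and `k ≈ n^(1/(β+1))` balances the
first two terms.

Lower bound. `exists_quadratic_risk_ge` is an Assouad argument with `m`-ary coordinates: a
coordinate whose chi-square information is small compared with `log m` cannot be identified, and
losses on disjoint sets of slots add up. For `α < 1`, each pair of blocks carries one bit, namely
whether a Hölder function dips at the corresponding grid point; this gives the nonparametric rate.
For `α ≥ 1`, one known graphon `c + a cos (ω x y)` is used and only positions are unknown: each of
`N ≈ n` nodes has one of about `n^γ` frequencies, which its edges to reference nodes reveal as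
orthogonal cosines. Identification fails while `n a²` is a small multiple of `log n`, so the risk is
at least of order `a² ≈ (log n)/n`. The power decay of `a` pays for the derivatives of the wave,
whose growth is a small power of `n`. -/

/-- The probability of `x` under the product of the Bernoulli laws with parameters `θ e`. -/
def bernoulliWeight {E : Type*} [Fintype E] (θ : E → ℝ) (x : E → Bool) : ℝ :=
  ∏ e, if x e then θ e else 1 - θ e

/-! ### Bernoulli product laws, chi-square bounds and Assouad's lemma -/

section Weight

variable {E : Type*} [Fintype E]

theorem bernoulliWeight_nonneg {θ : E → ℝ} (h : ∀ e, θ e ∈ Set.Icc (0 : ℝ) 1) (x : E → Bool) :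
    0 ≤ bernoulliWeight θ x := by
  refine Finset.prod_nonneg fun e _ => ?_
  have := h e
  split_ifs
  · exact this.1
  · linarith [this.2]

theorem bernoulliWeight_pos {θ : E → ℝ} (h : ∀ e, θ e ∈ Set.Ioo (0 : ℝ) 1) (x : E → Bool) :
    0 < bernoulliWeight θ x := by
  refine Finset.prod_pos fun e _ => ?_
  have := h e
  split_ifs
  · exact this.1
  · linarith [this.2]

theorem sum_prod_bool [DecidableEq E] (g : E → Bool → ℝ) :
    ∑ x : E → Bool, ∏ e, g e (x e) = ∏ e, (g e true + g e false) := by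
  have := Finset.prod_univ_sum (fun _ : E => (Finset.univ : Finset Bool)) g
  rw [Fintype.piFinset_univ] at this
  rw [← this]
  simp

theorem sum_bernoulliWeight [DecidableEq E] (θ : E → ℝ) : ∑ x, bernoulliWeight θ x = 1 := by
  unfold bernoulliWeight
  rw [sum_prod_bool (fun e b => if b then θ e else 1 - θ e)]
  simp

/-- The second moment of the likelihood ratio, that is, one plus the chi-square divergence,
factorizes over independent entries. -/
theorem sum_bernoulliWeight_sq_div [DecidableEq E] {θ θ₀ : E → ℝ}
    (h : ∀ e, θ₀ e ∈ Set.Ioo (0 : ℝ) 1) :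
    ∑ x, bernoulliWeight θ x ^ 2 / bernoulliWeight θ₀ x =
      ∏ e, (1 + (θ e - θ₀ e) ^ 2 / (θ₀ e * (1 - θ₀ e))) := by
  unfold bernoulliWeight
  simp_rw [← Finset.prod_pow, ← Finset.prod_div_distrib]
  rw [sum_prod_bool
    (fun e b => (if b then θ e else 1 - θ e) ^ 2 / (if b then θ₀ e else 1 - θ₀ e))]
  refine Finset.prod_congr rfl fun e _ => ?_
  have h1 := (h e).1.ne'
  have h2 : 1 - θ₀ e ≠ 0 := by linarith [(h e).2]
  simp only [if_true, Bool.false_eq_true, if_false]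
  field_simp
  ring

/-- Cauchy–Schwarz against the reference law on `A`, after which the second moment of the likelihood
ratio is enlarged from `A` to the whole space. -/
theorem sq_sum_bernoulliWeight_le [DecidableEq E] {θ θ₀ : E → ℝ}
    (h : ∀ e, θ₀ e ∈ Set.Ioo (0 : ℝ) 1) (A : Finset (E → Bool)) :
    (∑ x ∈ A, bernoulliWeight θ x) ^ 2 ≤ (∑ x ∈ A, bernoulliWeight θ₀ x) *
      ∏ e, (1 + (θ e - θ₀ e) ^ 2 / (θ₀ e * (1 - θ₀ e))) := by
  rw [← sum_bernoulliWeight_sq_div h]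
  have hp := bernoulliWeight_pos h
  calc (∑ x ∈ A, bernoulliWeight θ x) ^ 2
      ≤ (∑ x ∈ A, bernoulliWeight θ₀ x) *
          ∑ x ∈ A, bernoulliWeight θ x ^ 2 / bernoulliWeight θ₀ x := by
        refine Finset.sum_sq_le_sum_mul_sum_of_sq_le_mul A (fun x _ => (hp x).le)
          (fun x _ => div_nonneg (sq_nonneg _) (hp x).le) fun x _ => ?_
        rw [mul_div_cancel₀ _ (hp x).ne']
    _ ≤ _ := by
        refine mul_le_mul_of_nonneg_left ?_ (Finset.sum_nonneg fun x _ => (hp x).le)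
        exact Finset.sum_le_sum_of_subset_of_nonneg (Finset.subset_univ _)
          fun x _ _ => div_nonneg (sq_nonneg _) (hp x).le

/-- Among `m` Bernoulli product laws within chi-square distance `B - 1` of a common one, disjoint
acceptance regions have total power at most `√(B m)`. -/
theorem sum_power_le [DecidableEq E] {ι : Type*} [Fintype ι] [DecidableEq ι] {θ : ι → E → ℝ}
    {θ₀ : E → ℝ}
    (h : ∀ e, θ₀ e ∈ Set.Ioo (0 : ℝ) 1) {B : ℝ}
    (hB : ∀ z, ∏ e, (1 + (θ z e - θ₀ e) ^ 2 / (θ₀ e * (1 - θ₀ e))) ≤ B)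
    (A : ι → Finset (E → Bool)) (hA : ∀ z z', z ≠ z' → Disjoint (A z) (A z')) :
    ∑ z, ∑ x ∈ A z, bernoulliWeight (θ z) x ≤ √(B * Fintype.card ι) := by
  refine Real.le_sqrt_of_sq_le ?_
  have hp := bernoulliWeight_pos h
  have h1 : ∑ z, ∑ x ∈ A z, bernoulliWeight θ₀ x ≤ 1 := by
    rw [← Finset.sum_biUnion fun z _ z' _ hz => hA z z' hz, ← sum_bernoulliWeight θ₀]
    exact Finset.sum_le_sum_of_subset_of_nonneg (Finset.subset_univ _) fun x _ _ => (hp x).le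
  have h2 : ∀ z, (∑ x ∈ A z, bernoulliWeight (θ z) x) ^ 2 ≤
      (∑ x ∈ A z, bernoulliWeight θ₀ x) * B := fun z =>
    (sq_sum_bernoulliWeight_le h (A z)).trans
      (mul_le_mul_of_nonneg_left (hB z) (Finset.sum_nonneg fun x _ => (hp x).le))
  rcases isEmpty_or_nonempty ι with hι | ⟨⟨z₀⟩⟩
  · simp
  have hB0 : 0 ≤ B := le_trans (Finset.prod_nonneg fun e _ => by
    have := h e
    have : 0 < θ₀ e * (1 - θ₀ e) := mul_pos this.1 (by linarith [this.2])
    positivity) (hB z₀)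
  calc (∑ z, ∑ x ∈ A z, bernoulliWeight (θ z) x) ^ 2
      ≤ Fintype.card ι * ∑ z, (∑ x ∈ A z, bernoulliWeight (θ z) x) ^ 2 := by
        simpa using sq_sum_le_card_mul_sum_sq (s := Finset.univ)
          (f := fun z => ∑ x ∈ A z, bernoulliWeight (θ z) x)
    _ ≤ Fintype.card ι * ∑ z, (∑ x ∈ A z, bernoulliWeight θ₀ x) * B := by
        gcongr with z; exact h2 z
    _ ≤ Fintype.card ι * (1 * B) := by
        rw [← Finset.sum_mul]; gcongr
    _ = _ := by ring

/-- The Bayes quadratic risk for the uniform prior on `m` well separated Bernoulli product laws. -/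
theorem sum_quadratic_risk_ge [DecidableEq E] {ι : Type*} [Fintype ι] [DecidableEq ι]
    {θ : ι → E → ℝ} {θ₀ : E → ℝ}
    (hθ : ∀ z e, θ z e ∈ Set.Icc (0 : ℝ) 1) (h : ∀ e, θ₀ e ∈ Set.Ioo (0 : ℝ) 1) {B : ℝ}
    (hB : ∀ z, ∏ e, (1 + (θ z e - θ₀ e) ^ 2 / (θ₀ e * (1 - θ₀ e))) ≤ B)
    (F : Finset E) {D : ℝ} (hD : 0 ≤ D)
    (hsep : ∀ z z', z ≠ z' → D ≤ ∑ e ∈ F, (θ z e - θ z' e) ^ 2) (est : (E → Bool) → E → ℝ) :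
    D / 4 * (Fintype.card ι - √(B * Fintype.card ι)) ≤
      ∑ z, ∑ x, bernoulliWeight (θ z) x * ∑ e ∈ F, (est x e - θ z e) ^ 2 := by
  classical
  -- `A z` is the event that the estimator lands within squared distance `D / 4` of `θ z`. By `(u -
  -- v)² ≤ 2u² + 2v²`, landing that close to two parameters would contradict `hsep`, so these events
  -- are disjoint.
  set A : ι → Finset (E → Bool) := fun z =>
    {x | ∑ e ∈ F, (est x e - θ z e) ^ 2 < D / 4} with hAdef
  have hA : ∀ z z', z ≠ z' → Disjoint (A z) (A z') := by
    intro z z' hz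
    rw [Finset.disjoint_left]
    intro x hx hx'
    simp only [hAdef, Finset.mem_filter, Finset.mem_univ, true_and] at hx hx'
    have h1 := hsep z z' hz
    have h2 : ∑ e ∈ F, (θ z e - θ z' e) ^ 2 ≤
        2 * ∑ e ∈ F, (est x e - θ z e) ^ 2 + 2 * ∑ e ∈ F, (est x e - θ z' e) ^ 2 := by
      rw [Finset.mul_sum, Finset.mul_sum, ← Finset.sum_add_distrib]
      refine Finset.sum_le_sum fun e _ => ?_
      nlinarith [sq_nonneg ((est x e - θ z e) + (est x e - θ z' e))]
    linarith
  have hpow := sum_power_le h hB A hA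
  have key : ∀ z, D / 4 * (1 - ∑ x ∈ A z, bernoulliWeight (θ z) x) ≤
      ∑ x, bernoulliWeight (θ z) x * ∑ e ∈ F, (est x e - θ z e) ^ 2 := by
    intro z
    have hc : 1 - ∑ x ∈ A z, bernoulliWeight (θ z) x = ∑ x ∈ (A z)ᶜ, bernoulliWeight (θ z) x := by
      rw [← sum_bernoulliWeight (θ z), ← Finset.sum_add_sum_compl (A z)]; ring
    rw [hc, Finset.mul_sum]
    have hw := bernoulliWeight_nonneg (hθ z)
    calc ∑ x ∈ (A z)ᶜ, D / 4 * bernoulliWeight (θ z) x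
        ≤ ∑ x ∈ (A z)ᶜ, bernoulliWeight (θ z) x * ∑ e ∈ F, (est x e - θ z e) ^ 2 := by
          refine Finset.sum_le_sum fun x hx => ?_
          rw [mul_comm]
          refine mul_le_mul_of_nonneg_left ?_ (hw x)
          simpa [hAdef] using hx
      _ ≤ _ := Finset.sum_le_sum_of_subset_of_nonneg (Finset.subset_univ _) fun x _ _ =>
          mul_nonneg (hw x) (Finset.sum_nonneg fun e _ => sq_nonneg _)
  calc D / 4 * (Fintype.card ι - √(B * Fintype.card ι))
      ≤ D / 4 * (Fintype.card ι - ∑ z, ∑ x ∈ A z, bernoulliWeight (θ z) x) := by gcongr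
    _ = ∑ z, D / 4 * (1 - ∑ x ∈ A z, bernoulliWeight (θ z) x) := by
        rw [← Finset.mul_sum, Finset.sum_sub_distrib]; simp
    _ ≤ _ := Finset.sum_le_sum fun z _ => key z

/-- Resampling one coordinate preserves the uniform law: the swap of `z t` with the fresh value `s`
is an involution. -/
theorem sum_sum_update {T ι : Type*} [Fintype T] [DecidableEq T] [Fintype ι] [DecidableEq ι]
    (t : T) (g : (T → ι) → ℝ) :
    ∑ z : T → ι, ∑ s : ι, g (Function.update z t s) = Fintype.card ι * ∑ z, g z := by
  have hinv : Function.Involutive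
      (fun p : (T → ι) × ι => (Function.update p.1 t p.2, p.1 t)) := by
    rintro ⟨z, s⟩
    simp
  have := Equiv.sum_comp (hinv.toPerm) (fun p : (T → ι) × ι => g p.1)
  rw [Fintype.sum_prod_type, Fintype.sum_prod_type] at this
  simpa [Finset.mul_sum] using this

/-- A multi-parameter version of the Bayes bound (Assouad's lemma, with `m`-ary parameters): some
parameter `z : T → ι` has a large quadratic risk, if each coordinate `z t` acts only on a set `F t`
of slots, the sets `F t` being disjoint. -/
theorem exists_quadratic_risk_ge [DecidableEq E] {T ι : Type*} [Fintype T] [DecidableEq T]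
    [Fintype ι] [DecidableEq ι] [Nonempty ι]
    (θ : (T → ι) → E → ℝ) (hθ : ∀ z e, θ z e ∈ Set.Ioo (0 : ℝ) 1)
    {c : ℝ} (hc : c ∈ Set.Ioo (0 : ℝ) 1) (F : T → Finset E)
    (hF : ∀ t t', t ≠ t' → Disjoint (F t) (F t'))
    (hloc : ∀ z t s, ∀ e ∉ F t, θ (Function.update z t s) e = θ z e)
    {b : ℝ} (hb : ∀ z t, ∑ e ∈ F t, (θ z e - c) ^ 2 / (c * (1 - c)) ≤ b)
    {D : ℝ} (hD : 0 ≤ D) (hsep : ∀ z t s s', s ≠ s' →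
      D ≤ ∑ e ∈ F t, (θ (Function.update z t s) e - θ (Function.update z t s') e) ^ 2)
    (est : (E → Bool) → E → ℝ) :
    ∃ z, Fintype.card T * (D / 4 * (1 - √(Real.exp b / Fintype.card ι))) ≤
      ∑ x, bernoulliWeight (θ z) x * ∑ e, (est x e - θ z e) ^ 2 := by
  set m : ℝ := (Fintype.card ι : ℝ) with hm
  have hm0 : 0 < m := by rw [hm]; exact_mod_cast Fintype.card_pos
  have hc2 : 0 < c * (1 - c) := mul_pos hc.1 (by linarith [hc.2])
  have hθ' : ∀ z e, θ z e ∈ Set.Icc (0 : ℝ) 1 := fun z e => Set.Ioo_subset_Icc_self (hθ z e)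
  have hone : ∀ z t, D / 4 * (m - √(Real.exp b * m)) ≤
      ∑ s, ∑ x, bernoulliWeight (θ (Function.update z t s)) x *
        ∑ e ∈ F t, (est x e - θ (Function.update z t s) e) ^ 2 := by
    intro z t
    -- The reference law keeps `θ z` off `F t` and is constantly `c` on `F t`. Factors off `F t` are
    -- then `1` by `hloc`, and `1 + x ≤ exp x` on `F t` turns the chi-square product into `exp b`.
    refine sum_quadratic_risk_ge (θ := fun s => θ (Function.update z t s))
      (θ₀ := fun e => if e ∈ F t then c else θ z e) (fun s e => hθ' _ e) ?_ ?_ (F t) hD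
      (hsep z t) est
    · intro e
      split_ifs
      · exact hc
      · exact hθ z e
    · intro s
      calc ∏ e, (1 + (θ (Function.update z t s) e - if e ∈ F t then c else θ z e) ^ 2 /
            ((if e ∈ F t then c else θ z e) * (1 - if e ∈ F t then c else θ z e)))
          ≤ ∏ e, Real.exp (if e ∈ F t then
              (θ (Function.update z t s) e - c) ^ 2 / (c * (1 - c)) else 0) := by
            refine Finset.prod_le_prod (fun e _ => ?_) fun e _ => ?_
            · split_ifs with he
              · positivity
              · simp [hloc z t s e he]
            · split_ifs with he
              · linarith [Real.add_one_le_exp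
                  ((θ (Function.update z t s) e - c) ^ 2 / (c * (1 - c)))]
              · simp [hloc z t s e he]
        _ = Real.exp (∑ e ∈ F t, (θ (Function.update z t s) e - c) ^ 2 / (c * (1 - c))) := by
            rw [← Real.exp_sum]; simp
        _ ≤ Real.exp b := Real.exp_le_exp.2 (hb _ t)
  have hsq : m - √(Real.exp b * m) = m * (1 - √(Real.exp b / m)) := by
    have : Real.exp b * m = (Real.exp b / m) * m ^ 2 := by field_simp
    rw [this, Real.sqrt_mul (by positivity), Real.sqrt_sq hm0.le]; ring
  set R : (T → ι) → ℝ := fun z =>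
    ∑ x, bernoulliWeight (θ z) x * ∑ e, (est x e - θ z e) ^ 2 with hR
  set Z : ℝ := (Fintype.card (T → ι) : ℝ) with hZ
  -- Under the uniform prior on `z`, coordinate `t` may be resampled first, so the one-coordinate
  -- bound holds on average.
  have havg : ∀ t, Z * (D / 4 * (1 - √(Real.exp b / m))) ≤
      ∑ z, ∑ x, bernoulliWeight (θ z) x * ∑ e ∈ F t, (est x e - θ z e) ^ 2 := by
    intro t
    have h1 := sum_sum_update t (fun z =>
      ∑ x, bernoulliWeight (θ z) x * ∑ e ∈ F t, (est x e - θ z e) ^ 2)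
    have h2 : ∑ _z : T → ι, D / 4 * (m - √(Real.exp b * m)) ≤ _ :=
      Finset.sum_le_sum fun z _ => hone z t
    rw [h1, Finset.sum_const, Finset.card_univ, nsmul_eq_mul, hsq] at h2
    refine le_of_mul_le_mul_left ?_ hm0
    calc _ = Z * (D / 4 * (m * (1 - √(Real.exp b / m)))) := by ring
      _ ≤ _ := h2
  have htot : ∑ _z : T → ι, Fintype.card T * (D / 4 * (1 - √(Real.exp b / m))) ≤ ∑ z, R z := by
    calc ∑ _z : T → ι, Fintype.card T * (D / 4 * (1 - √(Real.exp b / m)))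
        = ∑ _t : T, Z * (D / 4 * (1 - √(Real.exp b / m))) := by
          rw [Finset.sum_const, Finset.card_univ, nsmul_eq_mul, Finset.sum_const,
            Finset.card_univ, nsmul_eq_mul]; ring
      _ ≤ ∑ t, ∑ z, ∑ x, bernoulliWeight (θ z) x * ∑ e ∈ F t, (est x e - θ z e) ^ 2 :=
          Finset.sum_le_sum fun t _ => havg t
      _ = ∑ z, ∑ x, bernoulliWeight (θ z) x * ∑ t, ∑ e ∈ F t, (est x e - θ z e) ^ 2 := by
          rw [Finset.sum_comm]
          refine Finset.sum_congr rfl fun z _ => ?_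
          rw [Finset.sum_comm]
          simp_rw [Finset.mul_sum]
      _ ≤ ∑ z, R z := by
          refine Finset.sum_le_sum fun z _ => Finset.sum_le_sum fun x _ =>
            mul_le_mul_of_nonneg_left ?_ (bernoulliWeight_nonneg (hθ' z) x)
          rw [← Finset.sum_biUnion fun t _ t' _ ht => hF t t' ht]
          exact Finset.sum_le_sum_of_subset_of_nonneg (Finset.subset_univ _)
            fun e _ _ => sq_nonneg _
  obtain ⟨z, -, hz⟩ := Finset.exists_le_of_sum_le Finset.univ_nonempty htot
  exact ⟨z, hz⟩

end Weight

/-! ### Reduction of the minimax risk to finite sums -/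

/-- The edge probabilities `θ_ij`, `j < i`. -/
def slotTheta {n : ℕ} (f : ℝ × ℝ → ℝ) (ξ : Fin n → unitInterval) (e : EdgeSlot n) : ℝ :=
  f ((ξ e.1.1 : ℝ), (ξ e.1.2 : ℝ))

theorem theta_slot {n : ℕ} (f : ℝ × ℝ → ℝ) (ξ : Fin n → unitInterval) (e : EdgeSlot n) :
    theta f ξ e.1.1 e.1.2 = slotTheta f ξ e := by
  unfold theta slotTheta
  rw [if_neg e.2.ne']

theorem edgeLaw_singleton {n : ℕ} {θ : Matrix (Fin n) (Fin n) ℝ}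
    (h : ∀ e : EdgeSlot n, θ e.1.1 e.1.2 ∈ Set.Icc (0 : ℝ) 1) (x : EdgeSlot n → Bool) :
    edgeLaw θ {x} = ENNReal.ofReal (bernoulliWeight (fun e => θ e.1.1 e.1.2) x) := by
  unfold edgeLaw bernoulliWeight
  rw [Measure.pi_singleton, ENNReal.ofReal_prod_of_nonneg]
  · refine Finset.prod_congr rfl fun e _ => ?_
    rw [Set.projIcc_of_mem _ (h e), bernoulliMeasure_apply _ (measurableSet_singleton _)]
    cases x e <;> simp [ENNReal.ofReal, unitInterval.toNNReal, Real.toNNReal_of_nonneg, (h e).1,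
      (h e).2] <;> rfl
  · intro e _
    have := h e
    split_ifs
    · exact this.1
    · linarith [this.2]

theorem lintegral_edgeLaw {n : ℕ} {θ : Matrix (Fin n) (Fin n) ℝ}
    (h : ∀ e : EdgeSlot n, θ e.1.1 e.1.2 ∈ Set.Icc (0 : ℝ) 1) {g : (EdgeSlot n → Bool) → ℝ}
    (hg : ∀ x, 0 ≤ g x) :
    ∫⁻ e, ENNReal.ofReal (g e) ∂(edgeLaw θ) =
      ENNReal.ofReal (∑ x, bernoulliWeight (fun e : EdgeSlot n => θ e.1.1 e.1.2) x * g x) := by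
  rw [lintegral_fintype, ENNReal.ofReal_sum_of_nonneg]
  · refine Finset.sum_congr rfl fun x _ => ?_
    rw [edgeLaw_singleton h, ENNReal.ofReal_mul (bernoulliWeight_nonneg h x), mul_comm]
  · exact fun x _ => mul_nonneg (bernoulliWeight_nonneg h x) (hg x)

theorem loss_nonneg {n : ℕ} (η θ : Matrix (Fin n) (Fin n) ℝ) : 0 ≤ loss η θ := by
  unfold loss; positivity

theorem slotTheta_mem {n : ℕ} {α M : ℝ} {f : ℝ × ℝ → ℝ} (hf : f ∈ graphonClass α M)
    (ξ : Fin n → unitInterval) (e : EdgeSlot n) : slotTheta f ξ e ∈ Set.Icc (0 : ℝ) 1 :=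
  hf.2 _ (ξ _).2 _ (ξ _).2

theorem lintegral_loss {n : ℕ} {α M : ℝ} {f : ℝ × ℝ → ℝ} (hf : f ∈ graphonClass α M)
    (est : Estimator n) (ξ : Fin n → unitInterval) :
    ∫⁻ e, ENNReal.ofReal (loss (est (adjacency e)) (theta f ξ)) ∂(edgeLaw (theta f ξ)) =
      ENNReal.ofReal (∑ x, bernoulliWeight (slotTheta f ξ) x *
        loss (est (adjacency x)) (theta f ξ)) := by
  have h : (fun e : EdgeSlot n => theta f ξ e.1.1 e.1.2) = slotTheta f ξ :=
    funext fun e => theta_slot f ξ e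
  rw [lintegral_edgeLaw (fun e => by rw [theta_slot]; exact slotTheta_mem hf ξ e)
    (fun x => loss_nonneg _ _), h]

/-- A bound for each fixed `ξ` integrates against any probability law. -/
theorem minimaxRisk_le {n : ℕ} {α M R : ℝ} (est : Estimator n)
    (h : ∀ f ∈ graphonClass α M, ∀ ξ : Fin n → unitInterval,
      ∑ x, bernoulliWeight (slotTheta f ξ) x * loss (est (adjacency x)) (theta f ξ) ≤ R) :
    minimaxRisk n α M ≤ ENNReal.ofReal R := by
  refine iInf_le_of_le est (iSup₂_le fun f hf => iSup_le fun P => ?_)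
  unfold risk
  calc _ ≤ ∫⁻ _ξ, ENNReal.ofReal R ∂(P : Measure (Fin n → unitInterval)) := by
        refine lintegral_mono fun ξ => ?_
        rw [lintegral_loss hf]
        exact ENNReal.ofReal_le_ofReal (h f hf ξ)
    _ = ENNReal.ofReal R := by simp

/-- Dirac laws are admissible, so the adversary may choose `ξ` itself. -/
theorem le_minimaxRisk {n : ℕ} {α M R : ℝ}
    (h : ∀ est : Estimator n, ∃ f ∈ graphonClass α M, ∃ ξ : Fin n → unitInterval,
      R ≤ ∑ x, bernoulliWeight (slotTheta f ξ) x * loss (est (adjacency x)) (theta f ξ)) :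
    ENNReal.ofReal R ≤ minimaxRisk n α M := by
  refine le_iInf fun est => ?_
  obtain ⟨f, hf, ξ, hξ⟩ := h est
  refine le_iSup₂_of_le f hf (le_iSup_of_le ⟨Measure.dirac ξ, inferInstance⟩ ?_)
  unfold risk
  rw [ProbabilityMeasure.coe_mk, lintegral_dirac, lintegral_loss hf]
  exact ENNReal.ofReal_le_ofReal hξ

theorem sum_slot_le {n : ℕ} {g : Fin n → Fin n → ℝ} (hg : ∀ i j, 0 ≤ g i j) :
    ∑ e : EdgeSlot n, g e.1.1 e.1.2 ≤ ∑ i, ∑ j, g i j := by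
  rw [← Fintype.sum_prod_type' g,
    ← Finset.sum_subtype (p := fun p : Fin n × Fin n => p.2 < p.1)
      (Finset.univ.filter fun p : Fin n × Fin n => p.2 < p.1) (by simp)
      (fun p => g p.1 p.2)]
  exact Finset.sum_le_sum_of_subset_of_nonneg (Finset.subset_univ _) fun p _ _ => hg _ _

theorem sum_slot_sq_le_loss {n : ℕ} (η : Matrix (Fin n) (Fin n) ℝ) (f : ℝ × ℝ → ℝ)
    (ξ : Fin n → unitInterval) :
    1 / (n : ℝ) ^ 2 * ∑ e : EdgeSlot n, (η e.1.1 e.1.2 - slotTheta f ξ e) ^ 2 ≤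
      loss η (theta f ξ) := by
  unfold loss
  refine mul_le_mul_of_nonneg_left ?_ (by positivity)
  simp_rw [← theta_slot]
  exact sum_slot_le (g := fun i j => (η i j - theta f ξ i j) ^ 2) fun i j => sq_nonneg _

/-- The lower bound for the minimax risk given by a finite family of graphons and latent vectors,
in the setting of `exists_quadratic_risk_ge`. -/
theorem minimaxRisk_ge {n : ℕ} {α M : ℝ} {T ι : Type*} [Fintype T] [DecidableEq T]
    [Fintype ι] [DecidableEq ι] [Nonempty ι] (f : (T → ι) → ℝ × ℝ → ℝ)
    (ξ : (T → ι) → Fin n → unitInterval) (hf : ∀ z, f z ∈ graphonClass α M)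
    (hθ : ∀ z e, slotTheta (f z) (ξ z) e ∈ Set.Ioo (0 : ℝ) 1)
    {c : ℝ} (hc : c ∈ Set.Ioo (0 : ℝ) 1) (F : T → Finset (EdgeSlot n))
    (hF : ∀ t t', t ≠ t' → Disjoint (F t) (F t'))
    (hloc : ∀ z t s, ∀ e ∉ F t, slotTheta (f (Function.update z t s)) (ξ (Function.update z t s)) e =
      slotTheta (f z) (ξ z) e)
    {b : ℝ} (hb : ∀ z t, ∑ e ∈ F t, (slotTheta (f z) (ξ z) e - c) ^ 2 / (c * (1 - c)) ≤ b)
    {D : ℝ} (hD : 0 ≤ D) (hsep : ∀ z t s s', s ≠ s' →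
      D ≤ ∑ e ∈ F t, (slotTheta (f (Function.update z t s)) (ξ (Function.update z t s)) e -
        slotTheta (f (Function.update z t s')) (ξ (Function.update z t s')) e) ^ 2) :
    ENNReal.ofReal (1 / (n : ℝ) ^ 2 *
      (Fintype.card T * (D / 4 * (1 - √(Real.exp b / Fintype.card ι))))) ≤
      minimaxRisk n α M := by
  refine le_minimaxRisk fun est => ?_
  obtain ⟨z, hz⟩ := exists_quadratic_risk_ge (fun z => slotTheta (f z) (ξ z)) hθ hc F hF hloc hb hD
    hsep (fun x e => est (adjacency x) e.1.1 e.1.2)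
  refine ⟨f z, hf z, ξ z, ?_⟩
  calc _ ≤ 1 / (n : ℝ) ^ 2 * ∑ x, bernoulliWeight (slotTheta (f z) (ξ z)) x *
        ∑ e : EdgeSlot n, (est (adjacency x) e.1.1 e.1.2 - slotTheta (f z) (ξ z) e) ^ 2 :=
        mul_le_mul_of_nonneg_left hz (by positivity)
    _ ≤ _ := by
      rw [Finset.mul_sum]
      refine Finset.sum_le_sum fun x _ => ?_
      rw [mul_left_comm]
      exact mul_le_mul_of_nonneg_left (sum_slot_sq_le_loss _ _ _)
        (bernoulliWeight_nonneg (slotTheta_mem (hf z) _) x)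

/-! ### Oracle inequality for least squares over a finite family -/

/-- For `|t| ≤ 1`, `exp t ≤ 1 + t + t²`; the linear terms cancel by centring and the variance is at
most `1`. -/
theorem bernoulli_mgf_le {θ s : ℝ} (hθ : θ ∈ Set.Icc (0 : ℝ) 1) (hs : |s| ≤ 1) :
    θ * Real.exp (s * (1 - θ)) + (1 - θ) * Real.exp (s * (0 - θ)) ≤ Real.exp (s ^ 2) := by
  obtain ⟨h0, h1⟩ := hθ
  have key : ∀ t : ℝ, |t| ≤ 1 → Real.exp t ≤ 1 + t + t ^ 2 := fun t ht => by
    linarith [(abs_le.1 (Real.abs_exp_sub_one_sub_id_le ht)).2]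
  have e1 := key (s * (1 - θ)) (by
    rw [abs_mul, abs_of_nonneg (by linarith : 0 ≤ 1 - θ)]
    exact mul_le_one₀ hs (by linarith) (by linarith))
  have e2 := key (s * (0 - θ)) (by
    rw [abs_mul, zero_sub, abs_neg, abs_of_nonneg h0]
    exact mul_le_one₀ hs h0 h1)
  have e3 := Real.add_one_le_exp (s ^ 2)
  have e4 : θ * (1 - θ) ≤ 1 := by nlinarith
  calc _ ≤ θ * (1 + s * (1 - θ) + (s * (1 - θ)) ^ 2) +
        (1 - θ) * (1 + s * (0 - θ) + (s * (0 - θ)) ^ 2) := by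
        gcongr
    _ = 1 + s ^ 2 * (θ * (1 - θ)) := by ring
    _ ≤ 1 + s ^ 2 * 1 := by gcongr
    _ ≤ _ := by linarith

section LeastSquares

variable {E : Type*} [Fintype E] [DecidableEq E]

/-- The penalty `u e ^ 2` compensates exactly the bound on each moment generating function, and
independence multiplies the factors. -/
theorem sum_weight_mul_exp_le {θ u : E → ℝ} (hθ : ∀ e, θ e ∈ Set.Icc (0 : ℝ) 1)
    (hu : ∀ e, |u e| ≤ 1) :
    ∑ x, bernoulliWeight θ x *
      Real.exp (∑ e, (u e * ((if x e then 1 else 0) - θ e) - u e ^ 2)) ≤ 1 := by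
  simp_rw [Real.exp_sum, bernoulliWeight, ← Finset.prod_mul_distrib]
  rw [sum_prod_bool (fun e b => (if b then θ e else 1 - θ e) *
    Real.exp (u e * ((if b then 1 else 0) - θ e) - u e ^ 2))]
  refine Finset.prod_le_one (fun e _ => ?_) fun e _ => ?_
  · have := hθ e
    have h2 : 0 ≤ 1 - θ e := by linarith [this.2]
    have h1 := this.1
    simp only [if_true, Bool.false_eq_true, if_false]
    positivity
  · have := bernoulli_mgf_le (hθ e) (hu e)
    simp only [if_true, Bool.false_eq_true, if_false, Real.exp_sub]
    rw [mul_div_assoc', mul_div_assoc', ← add_div]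
    exact (div_le_one (Real.exp_pos _)).2 this

/-- The oracle inequality for least squares over a finite family. -/
theorem sum_weight_mul_sq_le {ι : Type*} [Fintype ι] [Nonempty ι] {τ : ι → E → ℝ}
    (hτ : ∀ i e, τ i e ∈ Set.Icc (0 : ℝ) 1) {sel : (E → Bool) → ι}
    (hsel : ∀ x i, ∑ e, ((if x e then 1 else 0) - τ (sel x) e) ^ 2 ≤
      ∑ e, ((if x e then 1 else 0) - τ i e) ^ 2)
    {θ : E → ℝ} (hθ : ∀ e, θ e ∈ Set.Icc (0 : ℝ) 1) (i₀ : ι) :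
    ∑ x, bernoulliWeight θ x * ∑ e, (τ (sel x) e - θ e) ^ 2 ≤
      3 * ∑ e, (τ i₀ e - θ e) ^ 2 + 32 * Real.log (Fintype.card ι) := by
  set N : ℝ := (Fintype.card ι : ℝ) with hN
  have hN0 : 0 < N := by rw [hN]; exact_mod_cast Fintype.card_pos
  -- With the scale `1/8`, the cross term `2 (x - θ)(τ i - τ i₀)` equals `16 Y i` plus a quarter of
  -- `(τ i - τ i₀)²`, small enough to be absorbed into the left side.
  set u : ι → E → ℝ := fun i e => (τ i e - τ i₀ e) / 8 with hu
  set Y : ι → (E → Bool) → ℝ := fun i x =>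
    ∑ e, (u i e * ((if x e then 1 else 0) - θ e) - u i e ^ 2) with hY
  set S : ℝ := ∑ e, (τ i₀ e - θ e) ^ 2 with hS
  have hw := bernoulliWeight_nonneg hθ
  have hu1 : ∀ i e, |u i e| ≤ 1 := by
    intro i e
    have h1 := hτ i e
    have h2 := hτ i₀ e
    simp only [hu]
    rw [abs_le]
    constructor <;> linarith [h1.1, h1.2, h2.1, h2.2]
  have hmean : ∑ x, bernoulliWeight θ x * Y (sel x) x ≤ Real.log N := by
    -- The index `sel x` depends on the data, so `exp (Y (sel x) x)` is bounded by the sum over all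
    -- `i`; `y + 1 - log N ≤ exp y / N` brings this back to `Y`.
    have hY1 : ∀ x, Y (sel x) x ≤ (∑ i, Real.exp (Y i x)) / N + (Real.log N - 1) := by
      intro x
      have h1 := Real.add_one_le_exp (Y (sel x) x - Real.log N)
      rw [Real.exp_sub, Real.exp_log hN0] at h1
      have h2 : Real.exp (Y (sel x) x) ≤ ∑ i, Real.exp (Y i x) :=
        Finset.single_le_sum (f := fun i => Real.exp (Y i x)) (fun i _ => (Real.exp_pos _).le)
          (Finset.mem_univ (sel x))
      have h3 : Real.exp (Y (sel x) x) / N ≤ (∑ i, Real.exp (Y i x)) / N := by gcongr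
      linarith
    calc ∑ x, bernoulliWeight θ x * Y (sel x) x
        ≤ ∑ x, bernoulliWeight θ x * ((∑ i, Real.exp (Y i x)) / N + (Real.log N - 1)) :=
          Finset.sum_le_sum fun x _ => mul_le_mul_of_nonneg_left (hY1 x) (hw x)
      _ = (∑ i, ∑ x, bernoulliWeight θ x * Real.exp (Y i x)) / N + (Real.log N - 1) := by
          simp_rw [mul_add]
          rw [Finset.sum_add_distrib, ← Finset.sum_mul, sum_bernoulliWeight, one_mul,
            Finset.sum_comm, Finset.sum_div]
          simp_rw [← Finset.mul_sum, mul_div_assoc]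
      _ ≤ (∑ _i : ι, 1) / N + (Real.log N - 1) := by
          gcongr with i
          exact sum_weight_mul_exp_le hθ (hu1 i)
      _ = Real.log N := by
          rw [Finset.sum_const, Finset.card_univ, nsmul_eq_mul, mul_one, ← hN, div_self hN0.ne']
          ring
  have hpt : ∀ x, ∑ e, (τ (sel x) e - θ e) ^ 2 ≤ 3 * S + 32 * Y (sel x) x := by
    intro x
    have h0 := hsel x i₀
    have h1 : ∑ e, (τ (sel x) e - θ e) ^ 2 =
        ∑ e, ((if x e then 1 else 0) - τ (sel x) e) ^ 2 -
        ∑ e, ((if x e then 1 else 0) - τ i₀ e) ^ 2 + S +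
        ∑ e, 2 * ((if x e then 1 else 0) - θ e) * (τ (sel x) e - τ i₀ e) := by
      rw [hS, ← Finset.sum_sub_distrib, ← Finset.sum_add_distrib, ← Finset.sum_add_distrib]
      exact Finset.sum_congr rfl fun e _ => by ring
    have h2 : ∑ e, 2 * ((if x e then 1 else 0) - θ e) * (τ (sel x) e - τ i₀ e) =
        16 * Y (sel x) x + ∑ e, (τ (sel x) e - τ i₀ e) ^ 2 / 4 := by
      simp only [hY, hu]
      rw [Finset.mul_sum, ← Finset.sum_add_distrib]
      exact Finset.sum_congr rfl fun e _ => by ring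
    have h3 : ∑ e, (τ (sel x) e - τ i₀ e) ^ 2 / 4 ≤
        (∑ e, (τ (sel x) e - θ e) ^ 2) / 2 + S / 2 := by
      rw [hS, Finset.sum_div, Finset.sum_div, ← Finset.sum_add_distrib]
      refine Finset.sum_le_sum fun e _ => ?_
      nlinarith [sq_nonneg ((τ (sel x) e - θ e) + (τ i₀ e - θ e))]
    linarith
  calc ∑ x, bernoulliWeight θ x * ∑ e, (τ (sel x) e - θ e) ^ 2
      ≤ ∑ x, bernoulliWeight θ x * (3 * S + 32 * Y (sel x) x) :=
        Finset.sum_le_sum fun x _ => mul_le_mul_of_nonneg_left (hpt x) (hw x)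
    _ = 3 * S + 32 * ∑ x, bernoulliWeight θ x * Y (sel x) x := by
        simp_rw [mul_add]
        rw [Finset.sum_add_distrib, ← Finset.sum_mul, sum_bernoulliWeight, one_mul,
          Finset.mul_sum (f := fun x => bernoulliWeight θ x * Y (sel x) x)]
        exact congrArg _ (Finset.sum_congr rfl fun x _ => mul_left_comm _ _ _)
    _ ≤ _ := by gcongr

end LeastSquares

/-! ### Upper bound from a finite net -/

/-- The symmetric matrix with zero diagonal and the given entries below the diagonal. -/
def symmMatrix {n : ℕ} (t : EdgeSlot n → ℝ) : Matrix (Fin n) (Fin n) ℝ := fun i j =>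
  if h : j < i then t ⟨(i, j), h⟩ else if h' : i < j then t ⟨(j, i), h'⟩ else 0

theorem theta_eq_symmMatrix {n : ℕ} {α M : ℝ} {f : ℝ × ℝ → ℝ} (hf : f ∈ graphonClass α M)
    (ξ : Fin n → unitInterval) : theta f ξ = symmMatrix (slotTheta f ξ) := by
  ext i j
  unfold symmMatrix theta slotTheta
  rcases lt_trichotomy i j with h | h | h
  · rw [if_neg h.ne, dif_neg h.not_gt, dif_pos h]
    exact hf.1.2.2 _ (ξ i).2 _ (ξ j).2
  · simp [h]
  · rw [if_neg h.ne', dif_pos h]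

theorem loss_symmMatrix {n : ℕ} (t s : EdgeSlot n → ℝ) :
    loss (symmMatrix t) (symmMatrix s) = 2 / (n : ℝ) ^ 2 * ∑ e, (t e - s e) ^ 2 := by
  unfold loss
  have h1 : ∀ i j : Fin n, (symmMatrix t i j - symmMatrix s i j) ^ 2 =
      (if h : j < i then (t ⟨(i, j), h⟩ - s ⟨(i, j), h⟩) ^ 2 else 0) +
      (if h : i < j then (t ⟨(j, i), h⟩ - s ⟨(j, i), h⟩) ^ 2 else 0) := by
    intro i j
    unfold symmMatrix
    rcases lt_trichotomy i j with h | h | h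
    · simp [h, h.not_gt]
    · simp [h]
    · simp [h, h.not_gt]
  have h2 : ∑ i : Fin n, ∑ j : Fin n,
      (if h : j < i then (t ⟨(i, j), h⟩ - s ⟨(i, j), h⟩) ^ 2 else 0) =
      ∑ e, (t e - s e) ^ 2 := by
    rw [← Fintype.sum_prod_type' (fun i j : Fin n =>
      if h : j < i then (t ⟨(i, j), h⟩ - s ⟨(i, j), h⟩) ^ 2 else 0)]
    rw [← Finset.sum_subset (Finset.subset_univ
      (Finset.univ.filter fun p : Fin n × Fin n => p.2 < p.1))]
    · rw [Finset.sum_subtype (p := fun p : Fin n × Fin n => p.2 < p.1) _ (by simp)]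
      exact Finset.sum_congr rfl fun e _ => by simp [e.2]
    · intro p _ hp
      simp only [Finset.mem_filter, Finset.mem_univ, true_and] at hp
      simp [hp]
  simp_rw [h1, Finset.sum_add_distrib]
  rw [h2, Finset.sum_comm (γ := Fin n), h2]
  ring

/-- The upper bound for the minimax risk given by a finite net. -/
theorem minimaxRisk_le_of_net {n : ℕ} {α M : ℝ} {ι : Type*} [Fintype ι] [Nonempty ι]
    {τ : ι → EdgeSlot n → ℝ} (hτ : ∀ i e, τ i e ∈ Set.Icc (0 : ℝ) 1) {η : ℝ}
    (hnet : ∀ f ∈ graphonClass α M, ∀ ξ : Fin n → unitInterval, ∃ i, ∀ e,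
      |τ i e - slotTheta f ξ e| ≤ η) :
    minimaxRisk n α M ≤ ENNReal.ofReal
      (6 * η ^ 2 + 64 * Real.log (Fintype.card ι) / (n : ℝ) ^ 2) := by
  have hex : ∀ x : EdgeSlot n → Bool, ∃ i, ∀ i', ∑ e, ((if x e then 1 else 0) - τ i e) ^ 2 ≤
      ∑ e, ((if x e then (1 : ℝ) else 0) - τ i' e) ^ 2 := fun x => by
    obtain ⟨i, -, hi⟩ := Finset.exists_min_image (Finset.univ : Finset ι)
      (fun i => ∑ e, ((if x e then (1 : ℝ) else 0) - τ i e) ^ 2) Finset.univ_nonempty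
    exact ⟨i, fun i' => hi i' (Finset.mem_univ _)⟩
  choose sel hsel using hex
  have hadj : ∀ x : EdgeSlot n → Bool, (fun e => adjacency x e.1.1 e.1.2) = x := by
    intro x
    funext e
    simp [adjacency, e.2]
  -- The estimator is the least squares choice in the net, computed from the entries below the
  -- diagonal and symmetrized.
  refine minimaxRisk_le (fun A => symmMatrix (τ (sel fun e => A e.1.1 e.1.2))) fun f hf ξ => ?_
  obtain ⟨i₀, hi₀⟩ := hnet f hf ξ
  have hmain := sum_weight_mul_sq_le hτ hsel (fun e => slotTheta_mem hf ξ e) i₀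
  have hcard : ∑ e : EdgeSlot n, (τ i₀ e - slotTheta f ξ e) ^ 2 ≤ (n : ℝ) ^ 2 * η ^ 2 := by
    have h1 : ∑ e : EdgeSlot n, (τ i₀ e - slotTheta f ξ e) ^ 2 ≤ ∑ _e : EdgeSlot n, η ^ 2 :=
      Finset.sum_le_sum fun e _ => sq_le_sq.2 ((hi₀ e).trans (le_abs_self η))
    have h2 : (Fintype.card (EdgeSlot n) : ℝ) ≤ (n : ℝ) ^ 2 := by
      have := Fintype.card_subtype_le fun p : Fin n × Fin n => p.2 < p.1
      rw [Fintype.card_prod, Fintype.card_fin] at this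
      rw [sq]
      exact_mod_cast this
    rw [Finset.sum_const, Finset.card_univ, nsmul_eq_mul] at h1
    exact h1.trans (by gcongr)
  simp_rw [hadj, theta_eq_symmMatrix hf, loss_symmMatrix]
  have hc : (2 / (n : ℝ) ^ 2) * (n : ℝ) ^ 2 ≤ 2 := by
    rcases eq_or_ne (n : ℝ) 0 with h | h
    · simp [h]
    · field_simp; rfl
  calc _ = 2 / (n : ℝ) ^ 2 * ∑ x, bernoulliWeight (slotTheta f ξ) x *
        ∑ e, (τ (sel x) e - slotTheta f ξ e) ^ 2 := by
        rw [Finset.mul_sum]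
        exact Finset.sum_congr rfl fun x _ => by ring
    _ ≤ 2 / (n : ℝ) ^ 2 * (3 * ((n : ℝ) ^ 2 * η ^ 2) + 32 * Real.log (Fintype.card ι)) := by
        gcongr
        exact hmain.trans (by gcongr)
    _ = (2 / (n : ℝ) ^ 2 * (n : ℝ) ^ 2) * (3 * η ^ 2) +
        64 * Real.log (Fintype.card ι) / (n : ℝ) ^ 2 := by ring
    _ ≤ 2 * (3 * η ^ 2) + 64 * Real.log (Fintype.card ι) / (n : ℝ) ^ 2 := by gcongr
    _ = _ := by ring

/-! ### Hölder norms on the triangle -/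

theorem convex_triangle : Convex ℝ triangle := by
  rintro p ⟨hp1, hp2, hp3⟩ q ⟨hq1, hq2, hq3⟩ a b ha hb hab
  refine ⟨?_, ?_, ?_⟩ <;> simp only [Prod.fst_add, Prod.snd_add, Prod.smul_fst, Prod.smul_snd,
    smul_eq_mul]
  · positivity
  · gcongr
  · nlinarith

theorem uniqueDiffOn_triangle : UniqueDiffOn ℝ triangle := by
  refine uniqueDiffOn_convex convex_triangle ⟨((2 : ℝ) / 3, (1 : ℝ) / 3), ?_⟩
  rw [mem_interior]
  refine ⟨{p : ℝ × ℝ | 0 < p.2} ∩ ({p | p.2 < p.1} ∩ {p | p.1 < 1}), ?_, ?_, ?_⟩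
  · rintro p ⟨h1, h2, h3⟩
    exact ⟨le_of_lt h1, le_of_lt h2, le_of_lt h3⟩
  · exact (isOpen_lt continuous_const continuous_snd).inter
      ((isOpen_lt continuous_snd continuous_fst).inter (isOpen_lt continuous_fst continuous_const))
  · refine ⟨?_, ?_, ?_⟩ <;> simp only [Set.mem_ofPred_eq] <;> norm_num

theorem partialDeriv_zero (f : ℝ × ℝ → ℝ) (p : ℝ × ℝ) : partialDeriv 0 0 f p = f p := by
  unfold partialDeriv
  exact iteratedFDerivWithin_zero_apply _

section NormBounds

variable {α M : ℝ} {f : ℝ × ℝ → ℝ}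

theorem abs_partialDeriv_le (hM : 0 ≤ M) (hf : holderNorm α f ≤ ENNReal.ofReal M) {j k : ℕ}
    (hjk : j + k ≤ ⌊α⌋₊) {p : ℝ × ℝ} (hp : p ∈ triangle) : |partialDeriv j k f p| ≤ M := by
  have h1 := (le_self_add).trans hf
  have h2 : ENNReal.ofReal |partialDeriv j k f p| ≤ ENNReal.ofReal M :=
    le_trans (le_iSup₂_of_le j k <| le_iSup₂_of_le hjk p <|
      le_iSup (fun _ : p ∈ triangle => ENNReal.ofReal |partialDeriv j k f p|) hp) h1
  exact (ENNReal.ofReal_le_ofReal_iff hM).1 h2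

theorem abs_partialDeriv_sub_le (hM : 0 ≤ M) (hf : holderNorm α f ≤ ENNReal.ofReal M) {j k : ℕ}
    (hjk : j + k = ⌊α⌋₊) {p q : ℝ × ℝ} (hp : p ∈ triangle) (hq : q ∈ triangle) :
    |partialDeriv j k f p - partialDeriv j k f q| ≤
      M * (|p.1 - q.1| + |p.2 - q.2|) ^ (α - (⌊α⌋₊ : ℝ)) := by
  rcases eq_or_ne p q with rfl | hpq
  · simp only [sub_self, abs_zero]; positivity
  have h1 := (le_add_self).trans hf
  have h2 : ENNReal.ofReal (|partialDeriv j k f p - partialDeriv j k f q| /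
        (|p.1 - q.1| + |p.2 - q.2|) ^ (α - (⌊α⌋₊ : ℝ))) ≤ ENNReal.ofReal M :=
    le_trans (le_iSup₂_of_le j k <| le_iSup₂_of_le hjk p <| le_iSup₂_of_le hp q <|
      le_iSup₂ (f := fun (_ : q ∈ triangle) (_ : p ≠ q) =>
        ENNReal.ofReal (|partialDeriv j k f p - partialDeriv j k f q| /
          (|p.1 - q.1| + |p.2 - q.2|) ^ (α - (⌊α⌋₊ : ℝ)))) hq hpq) h1
  have h3 := (ENNReal.ofReal_le_ofReal_iff hM).1 h2
  have hpos : 0 < |p.1 - q.1| + |p.2 - q.2| := by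
    by_contra hcon
    have e1 := abs_nonneg (p.1 - q.1)
    have e2 := abs_nonneg (p.2 - q.2)
    refine hpq (Prod.ext ?_ ?_)
    · exact sub_eq_zero.1 (abs_eq_zero.1 (by linarith))
    · exact sub_eq_zero.1 (abs_eq_zero.1 (by linarith))
  exact (div_le_iff₀ (Real.rpow_pos_of_pos hpos _)).1 h3

theorem holderNorm_le {A B : ℝ} (hA : 0 ≤ A) (hB : 0 ≤ B)
    (h1 : ∀ j k, j + k ≤ ⌊α⌋₊ → ∀ p ∈ triangle, |partialDeriv j k f p| ≤ A)
    (h2 : ∀ j k, j + k = ⌊α⌋₊ → ∀ p ∈ triangle, ∀ q ∈ triangle,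
      |partialDeriv j k f p - partialDeriv j k f q| ≤
        B * (|p.1 - q.1| + |p.2 - q.2|) ^ (α - (⌊α⌋₊ : ℝ))) :
    holderNorm α f ≤ ENNReal.ofReal (A + B) := by
  rw [ENNReal.ofReal_add hA hB]
  unfold holderNorm
  refine add_le_add ?_ ?_
  · refine iSup₂_le fun j k => iSup₂_le fun hjk p => iSup_le fun hp => ?_
    exact ENNReal.ofReal_le_ofReal (h1 j k hjk p hp)
  · refine iSup₂_le fun j k => iSup₂_le fun hjk p => iSup₂_le fun hp q => iSup₂_le fun hq _ => ?_
    exact ENNReal.ofReal_le_ofReal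
      (div_le_of_le_mul₀ (by positivity) hB (h2 j k hjk p hp q hq))

end NormBounds

theorem norm_sub_le_ell_one (p q : ℝ × ℝ) : ‖p - q‖ ≤ |p.1 - q.1| + |p.2 - q.2| := by
  rw [Prod.norm_def]
  refine max_le ?_ ?_
  · simp
  · simp

theorem ell_one_le_two {p q : ℝ × ℝ} (hp : p ∈ triangle) (hq : q ∈ triangle) :
    |p.1 - q.1| + |p.2 - q.2| ≤ 2 := by
  obtain ⟨hp1, hp2, hp3⟩ := hp
  obtain ⟨hq1, hq2, hq3⟩ := hq
  have h1 : |p.1 - q.1| ≤ 1 := abs_le.2 ⟨by linarith, by linarith⟩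
  have h2 : |p.2 - q.2| ≤ 1 := abs_le.2 ⟨by linarith, by linarith⟩
  linarith

/-- Both first partials are at most `M`, so the derivative has norm at most `2 * M` for the sup norm
on the plane; the mean value inequality applies on the convex triangle. -/
theorem lipschitz_on_triangle {α M : ℝ} (hα : 1 ≤ α) (hM : 0 ≤ M) {f : ℝ × ℝ → ℝ}
    (hd : TimesDifferentiable ⌊α⌋₊ f) (hf : holderNorm α f ≤ ENNReal.ofReal M)
    {p q : ℝ × ℝ} (hp : p ∈ triangle) (hq : q ∈ triangle) :
    |f p - f q| ≤ 2 * M * (|p.1 - q.1| + |p.2 - q.2|) := by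
  have hfl : 1 ≤ ⌊α⌋₊ := Nat.floor_pos.2 hα
  have hdiff : DifferentiableOn ℝ f triangle := by
    have := hd 0 hfl
    rw [iteratedFDerivWithin_zero_eq_comp] at this
    exact (LinearIsometryEquiv.comp_differentiableOn_iff _).1 this
  have hbound : ∀ x ∈ triangle, ‖fderivWithin ℝ f triangle x‖ ≤ 2 * M := by
    intro x hx
    have h10 := abs_partialDeriv_le hM hf (j := 1) (k := 0) hfl hx
    have h01 := abs_partialDeriv_le hM hf (j := 0) (k := 1) hfl hx
    have e10 : partialDeriv 1 0 f x = fderivWithin ℝ f triangle x (1, 0) := by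
      unfold partialDeriv
      rw [iteratedFDerivWithin_one_apply (uniqueDiffOn_triangle x hx)]; simp
    have e01 : partialDeriv 0 1 f x = fderivWithin ℝ f triangle x (0, 1) := by
      unfold partialDeriv
      rw [iteratedFDerivWithin_one_apply (uniqueDiffOn_triangle x hx)]; simp
    refine ContinuousLinearMap.opNorm_le_bound _ (by positivity) fun v => ?_
    have hv : v = v.1 • ((1 : ℝ), (0 : ℝ)) + v.2 • ((0 : ℝ), (1 : ℝ)) := by
      ext <;> simp
    rw [e10] at h10
    rw [e01] at h01
    have hv1 : |v.1| ≤ ‖v‖ := by simpa using norm_fst_le v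
    have hv2 : |v.2| ≤ ‖v‖ := by simpa using norm_snd_le v
    calc ‖fderivWithin ℝ f triangle x v‖
        = |v.1 * fderivWithin ℝ f triangle x (1, 0) + v.2 * fderivWithin ℝ f triangle x (0, 1)| := by
          conv_lhs => rw [hv]
          rw [map_add, map_smul, map_smul, smul_eq_mul, smul_eq_mul, Real.norm_eq_abs]
      _ ≤ |v.1| * |fderivWithin ℝ f triangle x (1, 0)| +
          |v.2| * |fderivWithin ℝ f triangle x (0, 1)| := by
          rw [← abs_mul, ← abs_mul]; exact abs_add_le _ _
      _ ≤ ‖v‖ * M + ‖v‖ * M := by gcongr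
      _ = 2 * M * ‖v‖ := by ring
  have := convex_triangle.norm_image_sub_le_of_norm_fderivWithin_le hdiff hbound hq hp
  exact this.trans (by gcongr; exact norm_sub_le_ell_one p q)

theorem holder_on_triangle {α M : ℝ} (hM : 0 ≤ M) {f : ℝ × ℝ → ℝ}
    (hd : TimesDifferentiable ⌊α⌋₊ f) (hf : holderNorm α f ≤ ENNReal.ofReal M)
    {p q : ℝ × ℝ} (hp : p ∈ triangle) (hq : q ∈ triangle) :
    |f p - f q| ≤ 2 * M * (|p.1 - q.1| + |p.2 - q.2|) ^ min α 1 := by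
  rcases lt_or_ge α 1 with h | h
  · have h0 : ⌊α⌋₊ = 0 := Nat.floor_eq_zero.2 h
    have := abs_partialDeriv_sub_le hM hf (j := 0) (k := 0) h0.symm hp hq
    rw [partialDeriv_zero, partialDeriv_zero, h0, Nat.cast_zero, sub_zero] at this
    rw [min_eq_left h.le]
    refine this.trans ?_
    gcongr
    linarith
  · rw [min_eq_right h, Real.rpow_one]
    exact lipschitz_on_triangle h hM hd hf hp hq

/-- Sorting is nonexpansive for the `ℓ₁` distance, so symmetry carries regularity from the triangle
to the whole square. -/
theorem abs_max_sub_add_abs_min_sub_le (a b c d : ℝ) :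
    |max a b - max c d| + |min a b - min c d| ≤ |a - c| + |b - d| := by
  grind

/-- Members of the Hölder class are Hölder continuous on the square, with exponent `min α 1`. -/
theorem holder_on_square {α M : ℝ} (hα : 0 < α) (hM : 0 ≤ M) {f : ℝ × ℝ → ℝ}
    (hf : f ∈ holderClass α M) {x y x' y' : ℝ} (hx : x ∈ Set.Icc (0 : ℝ) 1)
    (hy : y ∈ Set.Icc (0 : ℝ) 1) (hx' : x' ∈ Set.Icc (0 : ℝ) 1) (hy' : y' ∈ Set.Icc (0 : ℝ) 1) :
    |f (x, y) - f (x', y')| ≤ 2 * M * (|x - x'| + |y - y'|) ^ min α 1 := by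
  have hsort : ∀ a ∈ Set.Icc (0 : ℝ) 1, ∀ b ∈ Set.Icc (0 : ℝ) 1,
      f (a, b) = f (max a b, min a b) ∧ (max a b, min a b) ∈ triangle := by
    intro a ha b hb
    refine ⟨?_, le_min ha.1 hb.1, min_le_max, max_le ha.2 hb.2⟩
    rcases le_total a b with h | h
    · rw [max_eq_right h, min_eq_left h]; exact hf.2.2 a ha b hb
    · rw [max_eq_left h, min_eq_right h]
  obtain ⟨e1, m1⟩ := hsort x hx y hy
  obtain ⟨e2, m2⟩ := hsort x' hx' y' hy'
  rw [e1, e2]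
  refine (holder_on_triangle hM hf.1 hf.2.1 m1 m2).trans ?_
  exact mul_le_mul_of_nonneg_left (Real.rpow_le_rpow (by positivity)
    (abs_max_sub_add_abs_min_sub_le x y x' y') (le_min hα.le zero_le_one)) (by positivity)

/-! ### Membership criteria -/

/-- A criterion for membership in the graphon class when `α < 1`. -/
theorem mem_graphonClass_of_holder {α M : ℝ} (hα : α < 1) (hM : 0 ≤ M) {f : ℝ × ℝ → ℝ}
    (h01 : ∀ p, f p ∈ Set.Icc (0 : ℝ) 1) (hsymm : ∀ x y, f (x, y) = f (y, x))
    (hle : ∀ p, f p ≤ M / 2)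
    (hhol : ∀ p q, |f p - f q| ≤ M / 2 * (|p.1 - q.1| + |p.2 - q.2|) ^ α) :
    f ∈ graphonClass α M := by
  have h0 : ⌊α⌋₊ = 0 := Nat.floor_eq_zero.2 hα
  refine ⟨⟨?_, ?_, fun x _ y _ => hsymm x y⟩, fun x _ y _ => h01 _⟩
  · intro i hi
    omega
  · rw [← add_halves M]
    refine holderNorm_le (by positivity) (by positivity) ?_ ?_
    · intro j k hjk p _
      obtain ⟨rfl, rfl⟩ : j = 0 ∧ k = 0 := by omega
      rw [partialDeriv_zero, abs_of_nonneg (h01 p).1]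
      exact hle p
    · intro j k hjk p _ q _
      obtain ⟨rfl, rfl⟩ : j = 0 ∧ k = 0 := by omega
      rw [partialDeriv_zero, partialDeriv_zero, h0, Nat.cast_zero, sub_zero]
      exact hhol p q

theorem partialDeriv_eq {f : ℝ × ℝ → ℝ} (hf : ContDiff ℝ ⊤ f) (j k : ℕ) {p : ℝ × ℝ}
    (hp : p ∈ triangle) : partialDeriv j k f p = iteratedFDeriv ℝ (j + k) f p
      (fun i => if (i : ℕ) < j then ((1 : ℝ), (0 : ℝ)) else ((0 : ℝ), (1 : ℝ))) := by
  unfold partialDeriv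
  rw [iteratedFDerivWithin_eq_iteratedFDeriv uniqueDiffOn_triangle
    (hf.contDiffAt.of_le (by simp)) hp]

theorem abs_apply_basis_le {n : ℕ} (j : ℕ)
    (T : ContinuousMultilinearMap ℝ (fun _ : Fin n => ℝ × ℝ) ℝ) :
    |T (fun i => if (i : ℕ) < j then ((1 : ℝ), (0 : ℝ)) else ((0 : ℝ), (1 : ℝ)))| ≤ ‖T‖ := by
  refine (T.le_opNorm _).trans (mul_le_of_le_one_right (norm_nonneg _) ?_)
  refine Finset.prod_le_one (fun i _ => norm_nonneg _) fun i _ => ?_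
  split_ifs <;> simp [Prod.norm_def]

/-- A criterion for membership in the graphon class, for smooth functions. -/
theorem mem_graphonClass_of_contDiff {α M : ℝ} (hα : 0 < α) (hM : 0 ≤ M) {f : ℝ × ℝ → ℝ}
    (hf : ContDiff ℝ ⊤ f) (h01 : ∀ p, f p ∈ Set.Icc (0 : ℝ) 1)
    (hsymm : ∀ x y, f (x, y) = f (y, x)) (hle : ∀ p, f p ≤ M / 2)
    (hder : ∀ s, 1 ≤ s → s ≤ ⌊α⌋₊ + 1 → ∀ p ∈ triangle, ‖iteratedFDeriv ℝ s f p‖ ≤ M / 4) :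
    f ∈ graphonClass α M := by
  refine ⟨⟨?_, ?_, fun x _ y _ => hsymm x y⟩, fun x _ y _ => h01 _⟩
  · intro i _
    exact (hf.contDiffOn (s := triangle)).differentiableOn_iteratedFDerivWithin (by simp)
      uniqueDiffOn_triangle
  · rw [← add_halves M]
    refine holderNorm_le (by positivity) (by positivity) ?_ ?_
    · intro j k hjk p hp
      rcases Nat.eq_zero_or_pos (j + k) with h | h
      · obtain ⟨rfl, rfl⟩ : j = 0 ∧ k = 0 := by omega
        rw [partialDeriv_zero, abs_of_nonneg (h01 p).1]
        exact hle p
      · rw [partialDeriv_eq hf j k hp]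
        exact (abs_apply_basis_le j _).trans ((hder _ h (by omega) p hp).trans (by linarith))
    · intro j k hjk p hp q hq
      rw [partialDeriv_eq hf j k hp, partialDeriv_eq hf j k hq, hjk.symm]
      have hd : ∀ x ∈ triangle, DifferentiableAt ℝ (iteratedFDeriv ℝ (j + k) f) x := fun x _ =>
        (hf.differentiable_iteratedFDeriv (by simp)).differentiableAt
      have hb : ∀ x ∈ triangle, ‖fderiv ℝ (iteratedFDeriv ℝ (j + k) f) x‖ ≤ M / 4 := fun x hx => by
        rw [norm_fderiv_iteratedFDeriv]
        exact hder _ (by omega) (by omega) x hx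
      have h1 := convex_triangle.norm_image_sub_le_of_norm_fderiv_le hd hb hq hp
      have h2 := abs_apply_basis_le j
        (iteratedFDeriv ℝ (j + k) f p - iteratedFDeriv ℝ (j + k) f q)
      rw [sub_apply] at h2
      set d : ℝ := |p.1 - q.1| + |p.2 - q.2| with hd
      have hd0 : 0 ≤ d := by positivity
      have hd2 : d ≤ 2 := ell_one_le_two hp hq
      set s : ℝ := α - ((j + k : ℕ) : ℝ) with hs
      have hs0 : 0 ≤ s := by
        rw [hs, hjk]; exact sub_nonneg.2 (Nat.floor_le hα.le)
      have hs1 : s ≤ 1 := by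
        have := Nat.lt_floor_add_one α
        rw [hs, hjk]; linarith
      -- The triangle has `ℓ₁`-diameter at most `2`, so a Lipschitz bound gives an `s`-Hölder bound
      -- for `s` in `[0, 1]` at the cost of a factor `2`. This is why `hder` asks for `M / 4`.
      have hkey : d ≤ 2 * d ^ s := by
        rcases eq_or_lt_of_le hd0 with h | h
        · rw [← h]; positivity
        · have e1 : d = d ^ (1 - s) * d ^ s := by
            rw [← Real.rpow_add h]; simp
          have e2 : d ^ (1 - s) ≤ 2 := by
            calc d ^ (1 - s) ≤ 2 ^ (1 - s) := by gcongr
              _ ≤ 2 ^ (1 : ℝ) := Real.rpow_le_rpow_of_exponent_le (by norm_num) (by linarith)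
              _ = 2 := by simp
          calc d = d ^ (1 - s) * d ^ s := e1
            _ ≤ 2 * d ^ s := by gcongr
      calc _ ≤ ‖iteratedFDeriv ℝ (j + k) f p - iteratedFDeriv ℝ (j + k) f q‖ := h2
        _ ≤ M / 4 * ‖p - q‖ := h1
        _ ≤ M / 4 * (2 * d ^ s) := by
            gcongr
            exact (norm_sub_le_ell_one p q).trans hkey
        _ = M / 2 * d ^ s := by ring

/-! ### Block approximation and the upper bound -/

/-- Round down, except at `x = 1`, where the index `k` is not available and `k - 1` serves. -/
theorem exists_grid_point {k : ℕ} (hk : 0 < k) {x : ℝ} (hx : x ∈ Set.Icc (0 : ℝ) 1) :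
    ∃ a : Fin k, |x - (a : ℕ) / (k : ℝ)| ≤ 1 / k := by
  have hk' : (0 : ℝ) < k := by exact_mod_cast hk
  have h0 : 0 ≤ x * k := mul_nonneg hx.1 hk'.le
  have key : ∀ y : ℝ, |x * k - y| ≤ 1 → |x - y / k| ≤ 1 / k := fun y hy => by
    have : x - y / k = (x * k - y) / k := by field_simp
    rw [this, abs_div, abs_of_pos hk']
    gcongr
  rcases lt_or_ge ⌊x * k⌋₊ k with h | h
  · refine ⟨⟨⌊x * k⌋₊, h⟩, key _ ?_⟩
    have h1 := Nat.floor_le h0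
    have h2 := Nat.lt_floor_add_one (x * k)
    exact abs_le.2 ⟨by linarith, by linarith⟩
  · refine ⟨⟨k - 1, by omega⟩, key _ ?_⟩
    have h1 : (k : ℝ) ≤ x * k := (Nat.le_floor_iff h0).1 h
    have h2 : x * k ≤ k := mul_le_of_le_one_left hk'.le hx.2
    push_cast [Nat.cast_sub (Nat.one_le_iff_ne_zero.2 hk.ne')]
    exact abs_le.2 ⟨by linarith, by linarith⟩

/-- The parameters of a discretized block matrix: the assignment of the nodes to the `k` blocks, the
value at the corner block, and the (shifted) increments along the first column and along the rows. -/
abbrev BlockIndex (n k K L : ℕ) : Type :=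
  (Fin n → Fin k) × Fin (K + 1) × (Fin k → Fin (2 * L + 1)) × (Fin k → Fin k → Fin (2 * L + 1))

/-- The integer value of a discretized block matrix at the block `(a, b)`. -/
def blockLevel {n k K L : ℕ} [NeZero k] (s : BlockIndex n k K L) (a b : Fin k) : ℤ :=
  ((s.2.1 : ℕ) : ℤ) + ∑ i ∈ Finset.range a, (((s.2.2.1 (Fin.ofNat k i) : ℕ) : ℤ) - L) +
    ∑ j ∈ Finset.range b, (((s.2.2.2 a (Fin.ofNat k j) : ℕ) : ℤ) - L)

/-- The edge probabilities of a discretized block matrix with mesh `δ`. -/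
def blockNet {n k K L : ℕ} [NeZero k] (δ : ℝ) (s : BlockIndex n k K L) (e : EdgeSlot n) : ℝ :=
  max 0 (min 1 (δ * blockLevel s (s.1 e.1.1) (s.1 e.1.2)))

theorem exists_fin_sub_eq {L : ℕ} {t : ℤ} (ht : |t| ≤ L) :
    ∃ v : Fin (2 * L + 1), ((v : ℕ) : ℤ) - L = t := by
  obtain ⟨h1, h2⟩ := abs_le.1 ht
  refine ⟨⟨(t + L).toNat, by omega⟩, ?_⟩
  simp only
  omega

/-- Every array of integers with small increments is one of the discretized block matrices. -/
theorem exists_blockLevel_eq {n k K L : ℕ} [NeZero k] (z : Fin n → Fin k) (G : ℕ → ℕ → ℤ)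
    (h0 : 0 ≤ G 0 0) (hK : G 0 0 ≤ K) (h1 : ∀ i < k, |G (i + 1) 0 - G i 0| ≤ L)
    (h2 : ∀ i < k, ∀ j < k, |G i (j + 1) - G i j| ≤ L) :
    ∃ s : BlockIndex n k K L, s.1 = z ∧ ∀ a b, blockLevel s a b = G a b := by
  choose d1 hd1 using fun i : Fin k => exists_fin_sub_eq (h1 i i.2)
  choose d2 hd2 using fun i j : Fin k => exists_fin_sub_eq (h2 i i.2 j j.2)
  refine ⟨(z, ⟨(G 0 0).toNat, by omega⟩, d1, d2), rfl, fun a b => ?_⟩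
  unfold blockLevel
  have e1 : ∑ i ∈ Finset.range a, (((d1 (Fin.ofNat k i) : ℕ) : ℤ) - L) = G a 0 - G 0 0 := by
    rw [← Finset.sum_range_sub (fun i => G i 0)]
    refine Finset.sum_congr rfl fun i hi => ?_
    have hi' : i < k := (Finset.mem_range.1 hi).trans a.2
    rw [hd1, Fin.val_ofNat, Nat.mod_eq_of_lt hi']
  have e2 : ∑ j ∈ Finset.range b, (((d2 a (Fin.ofNat k j) : ℕ) : ℤ) - L) = G a b - G a 0 := by
    rw [← Finset.sum_range_sub (fun j => G a j)]
    refine Finset.sum_congr rfl fun j hj => ?_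
    have hj' : j < k := (Finset.mem_range.1 hj).trans b.2
    rw [hd2, Fin.val_ofNat, Nat.mod_eq_of_lt hj']
  simp only
  rw [e1, e2, Int.toNat_of_nonneg h0]
  ring

theorem log_card_blockIndex {n k K L : ℕ} (hk : 0 < k) :
    Real.log (Fintype.card (BlockIndex n k K L)) =
      n * Real.log k + Real.log (K + 1) + (k + k ^ 2) * Real.log (2 * L + 1) := by
  have hk' : (k : ℝ) ≠ 0 := by exact_mod_cast hk.ne'
  have hK : ((K : ℝ) + 1) ≠ 0 := by positivity
  have hL : (2 * (L : ℝ) + 1) ≠ 0 := by positivity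
  simp only [BlockIndex, Fintype.card_prod, Fintype.card_pi, Fintype.card_fin, Finset.prod_const,
    Finset.card_univ]
  push_cast
  rw [Real.log_mul (by positivity) (by positivity), Real.log_mul (by positivity) (by positivity),
    Real.log_mul (by positivity) (by positivity), Real.log_pow, Real.log_pow, Real.log_pow,
    Real.log_pow]
  ring

theorem abs_floor_sub_floor_le {x y C : ℝ} {L : ℕ} (h : |x - y| ≤ C) (hL : C + 1 ≤ L) :
    |⌊x⌋ - ⌊y⌋| ≤ (L : ℤ) := by
  obtain ⟨h1, h2⟩ := abs_le.1 h
  have a1 := Int.floor_le x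
  have a2 := Int.lt_floor_add_one x
  have b1 := Int.floor_le y
  have b2 := Int.lt_floor_add_one y
  have : |((⌊x⌋ : ℝ) - ⌊y⌋)| ≤ L := abs_le.2 ⟨by linarith, by linarith⟩
  exact_mod_cast this

/-- The first term is the squared error of moving to the grid and rounding; the second is the
log-cardinality of the block net. -/
theorem minimaxRisk_le_of_blocks {α M : ℝ} (hα : 0 < α) (hM : 0 ≤ M) (n : ℕ) {k : ℕ} (hk : 0 < k) :
    minimaxRisk n α M ≤ ENNReal.ofReal (6 * ((1 + 4 * M) * (1 / (k : ℝ)) ^ min α 1) ^ 2 +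
      64 * (n * Real.log k + k + (k + k ^ 2) * Real.log (2 * (⌈2 * M⌉₊ + 1 : ℕ) + 1)) /
        (n : ℝ) ^ 2) := by
  have hk' : (0 : ℝ) < k := by exact_mod_cast hk
  have hk1 : (1 : ℝ) ≤ k := by exact_mod_cast hk
  have : NeZero k := ⟨hk.ne'⟩
  set β := min α 1 with hβ
  have hβ0 : 0 < β := lt_min hα zero_lt_one
  have hβ1 : β ≤ 1 := min_le_right _ _
  set δ : ℝ := (1 / (k : ℝ)) ^ β with hδ
  have hδ0 : 0 < δ := by positivity
  set K := ⌊1 / δ⌋₊ with hK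
  -- One grid step changes `g / δ` by at most `2 * M`, hence its floor by at most `2 * M + 1`. This
  -- bound does not depend on `k`, which keeps the entropy of the block values at `O(k²)`.
  set L := ⌈2 * M⌉₊ + 1 with hL
  have hLM : 2 * M + 1 ≤ (L : ℝ) := by
    rw [hL]; push_cast; linarith [Nat.le_ceil (2 * M)]
  have hgrid : ∀ i : ℕ, i ≤ k → (i : ℝ) / k ∈ Set.Icc (0 : ℝ) 1 := fun i hi =>
    ⟨by positivity, (div_le_one hk').2 (by exact_mod_cast hi)⟩
  have hKk : (K : ℝ) ≤ k := by
    calc (K : ℝ) ≤ 1 / δ := Nat.floor_le (by positivity)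
      _ = (k : ℝ) ^ β := by rw [hδ, one_div, one_div, Real.inv_rpow hk'.le, inv_inv]
      _ ≤ (k : ℝ) ^ (1 : ℝ) := Real.rpow_le_rpow_of_exponent_le hk1 hβ1
      _ = k := Real.rpow_one _
  have hnet := minimaxRisk_le_of_net (n := n) (α := α) (M := M) (ι := BlockIndex n k K L)
    (τ := blockNet δ) (η := (1 + 4 * M) * δ)
    (fun s e => ⟨le_max_left _ _, max_le zero_le_one (min_le_left _ _)⟩) ?_
  · refine hnet.trans (ENNReal.ofReal_le_ofReal ?_)
    rw [log_card_blockIndex hk]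
    have : Real.log (K + 1) ≤ k := by
      have := Real.log_le_sub_one_of_pos (by positivity : (0 : ℝ) < K + 1)
      linarith
    gcongr
  · intro f hf ξ
    choose z hz using fun i => exists_grid_point hk (ξ i).2
    set g : ℕ → ℕ → ℝ := fun a b => f ((a : ℝ) / k, (b : ℝ) / k) with hg
    have hstep : ∀ a ≤ k, ∀ b ≤ k, ∀ a' ≤ k, ∀ b' ≤ k,
        |(a : ℝ) / k - (a' : ℝ) / k| + |(b : ℝ) / k - (b' : ℝ) / k| ≤ 1 / k →
        |⌊g a b / δ⌋ - ⌊g a' b' / δ⌋| ≤ (L : ℤ) := by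
      intro a ha b hb a' ha' b' hb' h
      refine abs_floor_sub_floor_le (C := 2 * M) ?_ hLM
      rw [← sub_div, abs_div, abs_of_pos hδ0, div_le_iff₀ hδ0]
      refine (holder_on_square hα hM hf.1 (hgrid a ha) (hgrid b hb) (hgrid a' ha')
        (hgrid b' hb')).trans ?_
      rw [hδ]
      gcongr
    have hdiff : ∀ a : ℕ, |((a + 1 : ℕ) : ℝ) / k - (a : ℝ) / k| ≤ 1 / k := fun a => by
      have : ((a + 1 : ℕ) : ℝ) / k - (a : ℝ) / k = 1 / k := by push_cast; ring
      rw [this, abs_of_pos (by positivity)]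
    have hg01 : ∀ a ≤ k, ∀ b ≤ k, g a b ∈ Set.Icc (0 : ℝ) 1 := fun a ha b hb =>
      hf.2 _ (hgrid a ha) _ (hgrid b hb)
    obtain ⟨s, hs1, hs2⟩ := exists_blockLevel_eq (K := K) (L := L) z (fun a b => ⌊g a b / δ⌋)
      (Int.floor_nonneg.2 (div_nonneg (hg01 0 hk.le 0 hk.le).1 hδ0.le))
      (by
        rw [← Int.lt_add_one_iff, Int.floor_lt]
        push_cast
        exact (div_le_div_of_nonneg_right (hg01 0 hk.le 0 hk.le).2 hδ0.le).trans_lt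
          (Nat.lt_floor_add_one _))
      (fun i hi => hstep _ hi _ hk.le _ hi.le _ hk.le (by simpa using hdiff i))
      (fun i hi j hj => hstep _ hi.le _ hj _ hi.le _ hj.le (by simpa using hdiff j))
    refine ⟨s, fun e => ?_⟩
    set a := z e.1.1
    set b := z e.1.2
    have hG := hs2 a b
    have hgab := hg01 a a.2.le b b.2.le
    have hfl1 : δ * ⌊g a b / δ⌋ ≤ g a b := by
      have := mul_le_mul_of_nonneg_left (Int.floor_le (g a b / δ)) hδ0.le
      rwa [mul_div_cancel₀ _ hδ0.ne'] at this
    have hfl2 : g a b - δ ≤ δ * ⌊g a b / δ⌋ := by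
      have := mul_le_mul_of_nonneg_left (Int.lt_floor_add_one (g a b / δ)).le hδ0.le
      rw [mul_div_cancel₀ _ hδ0.ne'] at this
      linarith
    have hfl3 : 0 ≤ δ * (⌊g a b / δ⌋ : ℝ) := mul_nonneg hδ0.le (by
      exact_mod_cast Int.floor_nonneg.2 (div_nonneg hgab.1 hδ0.le))
    have hval : blockNet δ s e = δ * ⌊g a b / δ⌋ := by
      unfold blockNet
      rw [hs1, hG, min_eq_right (hfl1.trans hgab.2), max_eq_right hfl3]
    have hclose : |g a b - slotTheta f ξ e| ≤ 4 * M * δ := by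
      have h1 := holder_on_square hα hM hf.1 (hgrid a a.2.le) (hgrid b b.2.le) (ξ e.1.1).2
        (ξ e.1.2).2
      have h2 : |((a : ℕ) : ℝ) / k - ξ e.1.1| + |((b : ℕ) : ℝ) / k - ξ e.1.2| ≤ 2 * (1 / k) := by
        have h3 := hz e.1.1
        have h4 := hz e.1.2
        rw [abs_sub_comm] at h3 h4
        linarith
      refine h1.trans ?_
      calc _ ≤ 2 * M * (2 * (1 / (k : ℝ))) ^ β := by
            gcongr
        _ = 2 * M * (2 ^ β * δ) := by rw [Real.mul_rpow (by norm_num) (by positivity)]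
        _ ≤ 2 * M * (2 ^ (1 : ℝ) * δ) := by
            gcongr; norm_num
        _ = 4 * M * δ := by rw [Real.rpow_one]; ring
    rw [hval]
    obtain ⟨c1, c2⟩ := abs_le.1 hclose
    exact abs_le.2 ⟨by linarith, by linarith⟩

/-- The two terms of the upper bound are of the order of the rate. -/
theorem exists_le_rate {α : ℝ} (hα : 0 < α) : ∃ C : ℝ, 0 < C ∧ ∀ n : ℕ, 2 ≤ n →
    (n : ℝ) ^ (-(2 * min α 1 / (min α 1 + 1))) ≤ C * rate α n ∧
      Real.log n / n ≤ C * rate α n := by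
  rcases lt_or_ge α 1 with h | h
  -- Chosen so that `s - 1 = -(2 * α / (α + 1))`.
  · set s := (1 - α) / (α + 1) with hs
    have hs0 : 0 < s := div_pos (by linarith) (by linarith)
    refine ⟨max 1 (1 / s), by positivity, fun n hn => ?_⟩
    have hn0 : (0 : ℝ) < n := by positivity
    unfold rate
    rw [if_pos h, min_eq_left h.le]
    constructor
    · exact le_mul_of_one_le_left (by positivity) (le_max_left _ _)
    · calc Real.log n / n ≤ ((n : ℝ) ^ s / s) / n := by
            gcongr
            exact Real.log_le_rpow_div hn0.le hs0
        _ = 1 / s * ((n : ℝ) ^ s * (n : ℝ) ^ (-1 : ℝ)) := by rw [Real.rpow_neg_one]; ring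
        _ = 1 / s * (n : ℝ) ^ (-(2 * α / (α + 1))) := by
            rw [← Real.rpow_add hn0]
            congr 2
            rw [hs]; field_simp; ring
        _ ≤ _ := by gcongr; exact le_max_right _ _
  · refine ⟨max 1 (1 / Real.log 2), by positivity, fun n hn => ?_⟩
    have hn0 : (0 : ℝ) < n := by positivity
    have hlog2 : 0 < Real.log 2 := Real.log_pos (by norm_num)
    have hlog : Real.log 2 ≤ Real.log n := Real.log_le_log (by norm_num) (by exact_mod_cast hn)
    have hr : 0 ≤ Real.log n / n := by positivity
    unfold rate
    rw [if_neg h.not_gt, min_eq_right h]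
    constructor
    · calc (n : ℝ) ^ (-(2 * 1 / (1 + 1)) : ℝ) = 1 / n := by
            norm_num [Real.rpow_neg_one]
        _ ≤ (Real.log n / Real.log 2) / n := by
            gcongr; exact (one_le_div hlog2).2 hlog
        _ = 1 / Real.log 2 * (Real.log n / n) := by ring
        _ ≤ _ := by gcongr; exact le_max_right _ _
    · exact le_mul_of_one_le_left hr (le_max_left _ _)

/-- The number of blocks in both bounds. -/
theorem ceil_rpow_bounds {β : ℝ} (hβ : 0 < β) {n : ℕ} (hn : 2 ≤ n) :
    2 ≤ ⌈(n : ℝ) ^ (1 / (β + 1))⌉₊ ∧ ⌈(n : ℝ) ^ (1 / (β + 1))⌉₊ ≤ n ∧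
      (n : ℝ) ^ (1 / (β + 1)) ≤ ⌈(n : ℝ) ^ (1 / (β + 1))⌉₊ ∧
      (⌈(n : ℝ) ^ (1 / (β + 1))⌉₊ : ℝ) ≤ 2 * (n : ℝ) ^ (1 / (β + 1)) := by
  have hn1 : (1 : ℝ) < n := by exact_mod_cast hn
  have h1 : 1 < (n : ℝ) ^ (1 / (β + 1)) := Real.one_lt_rpow hn1 (by positivity)
  refine ⟨Nat.lt_ceil.2 (by exact_mod_cast h1), Nat.ceil_le.2 ?_, Nat.le_ceil _, ?_⟩
  · calc (n : ℝ) ^ (1 / (β + 1)) ≤ (n : ℝ) ^ (1 : ℝ) :=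
          Real.rpow_le_rpow_of_exponent_le hn1.le (by
            rw [div_le_one (by positivity)]; linarith)
      _ = n := Real.rpow_one _
  · linarith [Nat.ceil_lt_add_one (zero_le_one.trans h1.le)]

/-- For `k ≈ n^(1/(β+1))`, both `k^(-2β)` and `k²/n²` are of order `n^(-2β/(β+1))`; the node
assignment adds at most a multiple of `(log n)/n`. -/
theorem minimaxRisk_upper {α M : ℝ} (hα : 0 < α) (hM : 0 ≤ M) : ∃ C : ℝ, 0 < C ∧ ∀ n : ℕ, 2 ≤ n →
    minimaxRisk n α M ≤ ENNReal.ofReal (C * rate α n) := by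
  obtain ⟨C, hC, hrate⟩ := exists_le_rate hα
  set Λ := Real.log (2 * (⌈2 * M⌉₊ + 1 : ℕ) + 1) with hΛ
  have hΛ0 : 0 ≤ Λ := Real.log_nonneg (by push_cast; linarith [(Nat.cast_nonneg _ : (0 : ℝ) ≤ ⌈2 * M⌉₊)])
  refine ⟨(6 * (1 + 4 * M) ^ 2 + 64 * (4 * (1 + 2 * Λ)) + 64) * C, by positivity, fun n hn => ?_⟩
  obtain ⟨h1, h2⟩ := hrate n hn
  set β := min α 1 with hβ
  have hβ0 : 0 < β := lt_min hα zero_lt_one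
  obtain ⟨k2, kn, kl, ku⟩ := ceil_rpow_bounds hβ0 hn
  set k := ⌈(n : ℝ) ^ (1 / (β + 1))⌉₊ with hk
  have hn0 : (0 : ℝ) < n := by positivity
  have hk0 : (0 : ℝ) < k := by positivity
  have hk1 : (1 : ℝ) ≤ k := by exact_mod_cast (by omega : 1 ≤ k)
  set ρ := (n : ℝ) ^ (-(2 * β / (β + 1))) with hρ
  refine (minimaxRisk_le_of_blocks hα hM n (by omega : 0 < k)).trans (ENNReal.ofReal_le_ofReal ?_)
  have hδ : ((1 / (k : ℝ)) ^ β) ^ 2 ≤ ρ := by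
    calc ((1 / (k : ℝ)) ^ β) ^ 2 ≤ ((1 / (n : ℝ) ^ (1 / (β + 1))) ^ β) ^ 2 := by gcongr
      _ = ρ := by
        rw [one_div, ← Real.rpow_neg hn0.le, ← Real.rpow_mul hn0.le, ← Real.rpow_natCast,
          ← Real.rpow_mul hn0.le, hρ]
        congr 1
        push_cast; field_simp
  have hkk : (k : ℝ) ^ 2 / (n : ℝ) ^ 2 ≤ 4 * ρ := by
    calc (k : ℝ) ^ 2 / (n : ℝ) ^ 2 ≤ (2 * (n : ℝ) ^ (1 / (β + 1))) ^ 2 / (n : ℝ) ^ 2 := by gcongr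
      _ = 4 * (((n : ℝ) ^ (1 / (β + 1))) ^ 2 / (n : ℝ) ^ 2) := by ring
      _ = 4 * ρ := by
        rw [← Real.rpow_natCast, ← Real.rpow_natCast, ← Real.rpow_mul hn0.le, ← Real.rpow_sub hn0,
          hρ]
        congr 2
        push_cast; field_simp; ring
  have hlogk : Real.log k ≤ Real.log n := Real.log_le_log hk0 (by exact_mod_cast kn)
  have hkle : (k : ℝ) ≤ (k : ℝ) ^ 2 := by nlinarith
  calc 6 * ((1 + 4 * M) * (1 / (k : ℝ)) ^ β) ^ 2 +
        64 * (n * Real.log k + k + (k + k ^ 2) * Λ) / (n : ℝ) ^ 2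
      ≤ 6 * ((1 + 4 * M) * (1 / (k : ℝ)) ^ β) ^ 2 +
        64 * (n * Real.log n + k ^ 2 + (k ^ 2 + k ^ 2) * Λ) / (n : ℝ) ^ 2 := by gcongr
    _ = 6 * (1 + 4 * M) ^ 2 * ((1 / (k : ℝ)) ^ β) ^ 2 + 64 * (Real.log n / n) +
        64 * (1 + 2 * Λ) * ((k : ℝ) ^ 2 / (n : ℝ) ^ 2) := by field_simp; ring
    _ ≤ 6 * (1 + 4 * M) ^ 2 * (C * rate α n) + 64 * (C * rate α n) +
        64 * (1 + 2 * Λ) * (4 * (C * rate α n)) := by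
        gcongr
        · exact hδ.trans h1
        · exact hkk.trans (by gcongr)
    _ = _ := by ring

/-! ### Lower bound for `α < 1`: dips at grid points -/

theorem abs_rpow_sub_rpow_le {u v α : ℝ} (hu : 0 ≤ u) (hv : 0 ≤ v) (h0 : 0 ≤ α) (h1 : α ≤ 1) :
    |u ^ α - v ^ α| ≤ |u - v| ^ α := by
  wlog h : v ≤ u generalizing u v
  · rw [abs_sub_comm, abs_sub_comm u v]
    exact this hv hu (le_of_not_ge h)
  have h2 := Real.rpow_add_le_add_rpow hv (sub_nonneg.2 h) h0 h1
  rw [add_sub_cancel] at h2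
  rw [abs_of_nonneg (sub_nonneg.2 (by gcongr)), abs_of_nonneg (sub_nonneg.2 h)]
  linarith

/-- A Hölder function that is `c` on `S` and `c + L r ^ α` at distance at least `r` from `S`. -/
def dip (α c L r : ℝ) (S : Set (ℝ × ℝ)) (p : ℝ × ℝ) : ℝ :=
  c + L * (min r (Metric.infDist p S)) ^ α

theorem dip_of_mem {α c L r : ℝ} (hα : 0 < α) (hr : 0 ≤ r) {S : Set (ℝ × ℝ)} {p : ℝ × ℝ}
    (hp : p ∈ S) : dip α c L r S p = c := by
  unfold dip
  rw [Metric.infDist_zero_of_mem hp, min_eq_right hr, Real.zero_rpow hα.ne', mul_zero, add_zero]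

/-- Nonemptiness matters because `Metric.infDist` to the empty set is `0`, which would place every
point on the dip. -/
theorem dip_of_far {α c L r : ℝ} {S : Set (ℝ × ℝ)} (hS : S.Nonempty) {p : ℝ × ℝ}
    (hp : ∀ q ∈ S, r ≤ dist p q) : dip α c L r S p = c + L * r ^ α := by
  unfold dip
  rw [min_eq_left ((Metric.le_infDist hS).2 fun q hq => hp q hq)]

/-- The distance to `S` is `1`-Lipschitz and `t ↦ t ^ α` is `α`-Hölder with constant `1`. Values lie
between `c` and `2 * c`, and invariance of `S` under the swap gives symmetry. -/
theorem dip_mem_graphonClass {α M c L r : ℝ} (hα : 0 < α) (hα1 : α < 1) (hc : c ≤ 1 / 4)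
    (hcM : c ≤ M / 4) (hL : 0 ≤ L) (hLc : L ≤ c) (hr : 0 ≤ r) (hr1 : r ≤ 1) {S : Set (ℝ × ℝ)}
    (hS : ∀ p ∈ S, p.swap ∈ S) : dip α c L r S ∈ graphonClass α M := by
  have hmin : ∀ p, 0 ≤ min r (Metric.infDist p S) := fun p => le_min hr Metric.infDist_nonneg
  have hle : ∀ p, dip α c L r S p ≤ 2 * c := fun p => by
    have h1 : (min r (Metric.infDist p S)) ^ α ≤ 1 :=
      Real.rpow_le_one (hmin p) ((min_le_left _ _).trans hr1) hα.le
    have h2 := mul_le_mul_of_nonneg_left h1 hL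
    unfold dip
    linarith
  have hge : ∀ p, c ≤ dip α c L r S p := fun p => by
    have := mul_nonneg hL (Real.rpow_nonneg (hmin p) α)
    unfold dip
    linarith
  refine mem_graphonClass_of_holder hα1 (by linarith) (fun p => ⟨?_, ?_⟩) ?_ ?_ ?_
  · linarith [hge p]
  · linarith [hle p]
  · intro x y
    have hsw : Prod.swap '' S = S := by
      ext p
      constructor
      · rintro ⟨q, hq, rfl⟩
        exact hS q hq
      · exact fun hp => ⟨p.swap, hS p hp, p.swap_swap⟩
    have hiso : Isometry (Prod.swap : ℝ × ℝ → ℝ × ℝ) := Isometry.of_dist_eq fun p q => by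
      simp [Prod.dist_eq, max_comm]
    have := Metric.infDist_image hiso (x := (x, y)) (t := S)
    rw [hsw] at this
    unfold dip
    rw [← this, Prod.swap_prod_mk]
  · exact fun p => (hle p).trans (by linarith)
  · intro p q
    have e1 : dip α c L r S p - dip α c L r S q =
        L * ((min r (Metric.infDist p S)) ^ α - (min r (Metric.infDist q S)) ^ α) := by
      unfold dip; ring
    have e2 : |min r (Metric.infDist p S) - min r (Metric.infDist q S)| ≤
        |Metric.infDist p S - Metric.infDist q S| := by grind
    have e3 : |Metric.infDist p S - Metric.infDist q S| ≤ dist p q := by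
      have a1 := Metric.infDist_le_infDist_add_dist (s := S) (x := p) (y := q)
      have a2 := Metric.infDist_le_infDist_add_dist (s := S) (x := q) (y := p)
      rw [dist_comm q p] at a2
      exact abs_le.2 ⟨by linarith, by linarith⟩
    have e4 : dist p q ≤ |p.1 - q.1| + |p.2 - q.2| := by
      rw [dist_eq_norm]; exact norm_sub_le_ell_one p q
    rw [e1, abs_mul, abs_of_nonneg hL]
    refine mul_le_mul (by linarith) ?_ (abs_nonneg _) (by linarith)
    exact (abs_rpow_sub_rpow_le (hmin p) (hmin q) hα.le hα1.le).trans
      (Real.rpow_le_rpow (abs_nonneg _) (e2.trans (e3.trans e4)) hα.le)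

/-- The points of the `1/k`-grid selected by `z` and their mirror images, together with a point far
away (so that the set is never empty). -/
def gridSet (k : ℕ) (z : EdgeSlot k → Bool) : Set (ℝ × ℝ) :=
  {p | p = (5, 5) ∨ ∃ t, z t = true ∧
    (p = ((t.1.1 : ℕ) / (k : ℝ), (t.1.2 : ℕ) / (k : ℝ)) ∨
      p = ((t.1.2 : ℕ) / (k : ℝ), (t.1.1 : ℕ) / (k : ℝ)))}

theorem gridSet_swap {k : ℕ} {z : EdgeSlot k → Bool} {p : ℝ × ℝ} (hp : p ∈ gridSet k z) :
    p.swap ∈ gridSet k z := by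
  rcases hp with rfl | ⟨t, ht, rfl | rfl⟩
  · exact Or.inl rfl
  · exact Or.inr ⟨t, ht, Or.inr rfl⟩
  · exact Or.inr ⟨t, ht, Or.inl rfl⟩

theorem le_dist_grid {k : ℕ} (hk : 0 < k) {u v u' v' : ℕ} (h : ¬ (u = u' ∧ v = v')) :
    1 / (k : ℝ) ≤ dist ((u : ℝ) / k, (v : ℝ) / k) ((u' : ℝ) / k, (v' : ℝ) / k) := by
  have hk' : (0 : ℝ) < k := by exact_mod_cast hk
  have key : ∀ a b : ℕ, a ≠ b → 1 / (k : ℝ) ≤ dist ((a : ℝ) / k) ((b : ℝ) / k) := by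
    intro a b hab
    rw [Real.dist_eq, ← sub_div, abs_div, abs_of_pos hk']
    gcongr
    have : (1 : ℤ) ≤ |(a : ℤ) - b| := Int.one_le_abs (sub_ne_zero.2 (by exact_mod_cast hab))
    exact_mod_cast this
  rw [Prod.dist_eq]
  rcases not_and_or.1 h with h | h
  · exact (key _ _ h).trans (le_max_left _ _)
  · exact (key _ _ h).trans (le_max_right _ _)

-- Distinct grid points are `1/k` apart, so a dip of radius `1/k` does not reach its neighbours.
-- Mirror images lie strictly above the diagonal and never meet a point with `v ≤ u`.
open Classical in
theorem dip_gridSet {α c L : ℝ} (hα : 0 < α) {k : ℕ} (hk : 0 < k) (z : EdgeSlot k → Bool)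
    {u v : ℕ} (huk : u ≤ k) (hvu : v ≤ u) :
    dip α c L (1 / k) (gridSet k z) ((u : ℝ) / k, (v : ℝ) / k) =
      c + if ∃ t, z t = true ∧ (t.1.1 : ℕ) = u ∧ (t.1.2 : ℕ) = v then 0 else L * (1 / k) ^ α := by
  have hk' : (0 : ℝ) < k := by exact_mod_cast hk
  split_ifs with h
  · obtain ⟨t, ht, rfl, rfl⟩ := h
    rw [dip_of_mem hα (by positivity) (Or.inr ⟨t, ht, Or.inl rfl⟩), add_zero]
  · refine dip_of_far ⟨_, Or.inl rfl⟩ ?_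
    rintro q (rfl | ⟨t, ht, rfl | rfl⟩)
    · have h1 : (u : ℝ) / k ≤ 1 := (div_le_one hk').2 (by exact_mod_cast huk)
      have h2 : 1 / (k : ℝ) ≤ 1 := (div_le_one hk').2 (by exact_mod_cast hk)
      rw [Prod.dist_eq]
      refine le_trans ?_ (le_max_left _ _)
      rw [Real.dist_eq, abs_sub_comm]
      exact le_trans (by linarith) (le_abs_self _)
    · exact le_dist_grid hk fun hh => h ⟨t, ht, hh.1.symm, hh.2.symm⟩
    · refine le_dist_grid hk fun hh => ?_
      have : (t.1.2 : ℕ) < t.1.1 := t.2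
      omega

/-- The slots between two blocks of `q` consecutive nodes. -/
def blockSlots (n q s t : ℕ) : Finset (EdgeSlot n) :=
  {e | (e.1.1 : ℕ) / q = s ∧ (e.1.2 : ℕ) / q = t}

theorem card_blockSlots {n q k s t : ℕ} (hq : 0 < q) (hqk : k * q ≤ n) (hs : s < k) (hts : t < s) :
    (blockSlots n q s t).card = q ^ 2 := by
  have hb : ∀ a < k, ∀ u < q, a * q + u < n := fun a ha u hu => by
    have : (a + 1) * q ≤ k * q := Nat.mul_le_mul_right q ha
    rw [add_mul, one_mul] at this
    omega
  have hdiv : ∀ a u, u < q → (a * q + u) / q = a := fun a u hu => by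
    rw [mul_comm, Nat.mul_add_div hq, Nat.div_eq_of_lt hu, add_zero]
  have hmod : ∀ a u, u < q → (a * q + u) % q = u := fun a u hu => by
    rw [mul_comm, Nat.mul_add_mod, Nat.mod_eq_of_lt hu]
  have hord : ∀ u v, v < q → t * q + v < s * q + u := fun u v hv => by
    have : (t + 1) * q ≤ s * q := Nat.mul_le_mul_right q hts
    rw [add_mul, one_mul] at this
    omega
  rw [sq, ← Finset.card_range q, ← Finset.card_product, Finset.card_range]
  refine Finset.card_nbij' (fun e => ((e.1.1 : ℕ) % q, (e.1.2 : ℕ) % q))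
    (fun p => if h : p.1 < q ∧ p.2 < q then
      ⟨(⟨s * q + p.1, hb s hs _ h.1⟩, ⟨t * q + p.2, hb t (hts.trans hs) _ h.2⟩), hord _ _ h.2⟩
      -- A default value that only makes the inverse total; it is never used on the product of
      -- ranges.
      else ⟨(⟨s * q + 0, hb s hs _ hq⟩, ⟨t * q + 0, hb t (hts.trans hs) _ hq⟩), hord _ _ hq⟩)
    ?_ ?_ ?_ ?_
  · intro e _
    simp [Nat.mod_lt _ hq]
  · intro p hp
    have hp' : p.1 < q ∧ p.2 < q := by simpa using hp
    simp [blockSlots, hp', hdiv]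
  · intro e he
    have he' : (e.1.1 : ℕ) / q = s ∧ (e.1.2 : ℕ) / q = t := by simpa [blockSlots] using he
    obtain ⟨rfl, rfl⟩ := he'
    have h : (e.1.1 : ℕ) % q < q ∧ (e.1.2 : ℕ) % q < q := ⟨Nat.mod_lt _ hq, Nat.mod_lt _ hq⟩
    refine (dif_pos h).trans ?_
    ext <;> simp [Nat.div_add_mod']
  · intro p hp
    have hp' : p.1 < q ∧ p.2 < q := by simpa using hp
    simp [hp', hmod]

theorem card_edgeSlot_ge {k : ℕ} (hk : 2 ≤ k) : (k : ℝ) ^ 2 / 4 ≤ Fintype.card (EdgeSlot k) := by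
  have h1 : Fintype.card (EdgeSlot k) = ∑ i ∈ Finset.range k, i := by
    rw [Fintype.card_subtype, Finset.card_filter, Fintype.sum_prod_type,
      ← Fin.sum_univ_eq_sum_range (fun i => i)]
    refine Finset.sum_congr rfl fun i _ => ?_
    dsimp only
    rw [← Finset.card_filter, ← Fin.card_Iio]
    congr 1
    ext j
    simp
  have h2 := Finset.sum_range_id_mul_two k
  rw [← h1] at h2
  have h3 : (Fintype.card (EdgeSlot k) : ℝ) * 2 = k * (k - 1) := by
    rw [← Nat.cast_pred (by omega)]
    exact_mod_cast h2
  have hk' : (2 : ℝ) ≤ k := by exact_mod_cast hk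
  nlinarith

/-- The failure probability left for a binary coordinate with `b ≤ 1 / 3`. -/
theorem one_eighth_le_one_sub_sqrt {b : ℝ} (hb : b ≤ 1 / 3) :
    1 / 8 ≤ 1 - √(Real.exp b / 2) := by
  have h1 : Real.exp (1 / 3) ≤ 3 / 2 := by
    have h := Real.add_one_le_exp (-(1 / 3) : ℝ)
    have h' : Real.exp (1 / 3) * Real.exp (-(1 / 3)) = 1 := by rw [← Real.exp_add]; simp
    nlinarith [Real.exp_pos (1 / 3)]
  have h2 : √(Real.exp b / 2) ≤ 7 / 8 := by
    refine Real.sqrt_le_iff.2 ⟨by norm_num, ?_⟩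
    have := Real.exp_le_exp.2 hb
    linarith
  linarith

/-- The lower bound for `α < 1`, in terms of the number `k` of blocks and their size `q`. -/
theorem minimaxRisk_ge_of_blocks {α M c : ℝ} (hα : 0 < α) (hα1 : α < 1) (hc0 : 0 < c)
    (hc : c ≤ 1 / 4) (hcM : c ≤ M / 4) {n k q : ℕ} (hk : 2 ≤ k) (hq : 0 < q) (hqk : k * q ≤ n)
    (hkq : q * (1 / (k : ℝ)) ^ α ≤ 1) :
    ENNReal.ofReal (1 / (n : ℝ) ^ 2 *
      ((k : ℝ) ^ 2 / 4 * (q ^ 2 * (c * (1 / k) ^ α) ^ 2 / 4 * (1 / 8)))) ≤ minimaxRisk n α M := by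
  classical
  have hk0 : 0 < k := by omega
  have hk' : (0 : ℝ) < k := by exact_mod_cast hk0
  have hk1 : 1 / (k : ℝ) ≤ 1 := (div_le_one hk').2 (by exact_mod_cast hk0)
  set a : ℝ := c * (1 / k) ^ α with ha
  have ha0 : 0 ≤ a := by positivity
  have hac : a ≤ c := mul_le_of_le_one_right hc0.le
    (Real.rpow_le_one (by positivity) hk1 hα.le)
  -- Nodes left over after `k` blocks of size `q` are sent to class `k`, which no slot of `EdgeSlot
  -- k` uses, so their edges carry no information.
  set cl : Fin n → ℕ := fun i => min ((i : ℕ) / q) k with hcl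
  have hclk : ∀ i, cl i ≤ k := fun i => min_le_right _ _
  set ξ : Fin n → unitInterval := fun i => ⟨(cl i : ℝ) / k, by positivity,
    (div_le_one hk').2 (by exact_mod_cast hclk i)⟩ with hξ
  set f : (EdgeSlot k → Bool) → ℝ × ℝ → ℝ := fun z => dip α c c (1 / k) (gridSet k z) with hf
  have hval : ∀ z e, slotTheta (f z) ξ e = c + if ∃ t, z t = true ∧ (t.1.1 : ℕ) = cl e.1.1 ∧
      (t.1.2 : ℕ) = cl e.1.2 then 0 else a := fun z e => by
    refine dip_gridSet hα hk0 z (hclk _) ?_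
    have : (e.1.2 : ℕ) ≤ e.1.1 := le_of_lt e.2
    exact min_le_min_right _ (Nat.div_le_div_right this)
  set F : EdgeSlot k → Finset (EdgeSlot n) := fun t => blockSlots n q t.1.1 t.1.2 with hF
  have hmemF : ∀ t e, e ∈ F t ↔ (t.1.1 : ℕ) = cl e.1.1 ∧ (t.1.2 : ℕ) = cl e.1.2 := fun t e => by
    have h1 := t.1.1.2
    have h2 := t.1.2.2
    simp only [hF, blockSlots, hcl, Finset.mem_filter, Finset.mem_univ, true_and]
    omega
  have huniq : ∀ t t' e, e ∈ F t → e ∈ F t' → t = t' := fun t t' e h h' => by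
    rw [hmemF] at h h'
    exact Subtype.ext (Prod.ext (Fin.ext (h.1.trans h'.1.symm)) (Fin.ext (h.2.trans h'.2.symm)))
  have hcardF : ∀ t, ((F t).card : ℝ) = (q : ℝ) ^ 2 := fun t => by
    exact_mod_cast card_blockSlots hq hqk t.1.1.2 t.2
  have hvalF : ∀ z t e, e ∈ F t → slotTheta (f z) ξ e = c + if z t = true then 0 else a := by
    intro z t e he
    rw [hval]
    congr 2
    refine propext ⟨?_, fun h => ⟨t, h, (hmemF t e).1 he⟩⟩
    rintro ⟨t', h', ht'⟩
    rwa [huniq t t' e he ((hmemF t' e).2 ht')]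
  have hmain := minimaxRisk_ge (n := n) (α := α) (M := M) f (fun _ => ξ)
    (fun z => dip_mem_graphonClass hα hα1 hc hcM hc0.le le_rfl (by positivity) hk1
      fun p hp => gridSet_swap hp)
    (c := c) (b := 1 / 3) (D := q ^ 2 * a ^ 2) ?_ ⟨hc0, by linarith⟩ F ?_ ?_ ?_ (by positivity) ?_
  · refine le_trans (ENNReal.ofReal_le_ofReal ?_) hmain
    rw [Fintype.card_bool]
    gcongr
    · exact card_edgeSlot_ge hk
    · exact_mod_cast one_eighth_le_one_sub_sqrt le_rfl
  · intro z e
    rw [hval]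
    split_ifs
    · exact ⟨by linarith, by linarith⟩
    · exact ⟨by linarith, by linarith⟩
  · intro t t' h
    exact Finset.disjoint_left.2 fun e he he' => h (huniq t t' e he he')
  · intro z t s e he
    rw [hval, hval]
    congr 2
    refine propext (exists_congr fun t' => and_congr_left fun ht' => ?_)
    have : t' ≠ t := by
      rintro rfl
      exact he ((hmemF _ _).2 ht')
    rw [Function.update_of_ne this]
  · intro z t
    calc ∑ e ∈ F t, (slotTheta (f z) ξ e - c) ^ 2 / (c * (1 - c))
        ≤ ∑ _e ∈ F t, a ^ 2 / (c * (3 / 4)) := by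
          refine Finset.sum_le_sum fun e he => ?_
          rw [hvalF z t e he, add_sub_cancel_left]
          gcongr
          · split_ifs <;> simp [ha0]
          · linarith
      _ = (q * (1 / (k : ℝ)) ^ α) ^ 2 * (4 / 3 * c) := by
          rw [Finset.sum_const, nsmul_eq_mul, hcardF, ha]
          field_simp
      -- The hypothesis `hkq` says that the `q ^ 2` edges of a pair of blocks carry bounded
      -- information about its bit.
      _ ≤ 1 ^ 2 * (4 / 3 * (1 / 4)) := by gcongr
      _ = 1 / 3 := by norm_num
  · intro z t s s' hs
    rw [← hcardF t, ← nsmul_eq_mul, ← Finset.sum_const]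
    refine Finset.sum_le_sum fun e he => ?_
    rw [hvalF _ t e he, hvalF _ t e he, Function.update_self, Function.update_self]
    rcases s with _ | _ <;> rcases s' with _ | _
    · exact absurd rfl hs
    · simp
    · simp
    · exact absurd rfl hs

/-- With `k ≈ n^(1/(α+1))` blocks of size `q = n / k`, `q k^(-α) ≤ n / k^(α+1) ≤ 1`. Almost all of
the matrix is covered up to a constant, since `n ≤ 2 k q`, so the risk is of order `k^(-2α)`. -/
theorem minimaxRisk_lower_of_lt_one {α M : ℝ} (hα : 0 < α) (hα1 : α < 1) (hM : 0 < M) :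
    ∃ C : ℝ, 0 < C ∧ ∀ n : ℕ, 2 ≤ n → ENNReal.ofReal (C * rate α n) ≤ minimaxRisk n α M := by
  set c : ℝ := min 1 M / 4 with hc
  have hc0 : 0 < c := div_pos (lt_min one_pos hM) (by norm_num)
  refine ⟨c ^ 2 / 2048, by positivity, fun n hn => ?_⟩
  obtain ⟨k2, kn, kl, ku⟩ := ceil_rpow_bounds hα hn
  set k := ⌈(n : ℝ) ^ (1 / (α + 1))⌉₊ with hk
  have hn0 : (0 : ℝ) < n := by positivity
  have hk0 : (0 : ℝ) < k := by positivity
  set q := n / k with hq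
  have hq0 : 0 < q := Nat.div_pos kn (by omega)
  have hqn : k * q ≤ n := Nat.mul_div_le n k
  have hqn' : (q : ℝ) ≤ n / k := Nat.cast_div_le
  have hnq : (n : ℝ) ≤ 2 * (k * q) := by
    have h1 : n < k * (q + 1) := Nat.lt_mul_div_succ n (by omega)
    have h2 : k * (q + 1) ≤ k * (q + q) := Nat.mul_le_mul_left k (by omega)
    have h3 : n ≤ 2 * (k * q) := by
      have : k * (q + q) = 2 * (k * q) := by ring
      omega
    exact_mod_cast h3
  have hkα : (n : ℝ) ≤ (k : ℝ) ^ (α + 1) := by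
    calc (n : ℝ) = ((n : ℝ) ^ (1 / (α + 1))) ^ (α + 1) := by
          rw [← Real.rpow_mul hn0.le, one_div_mul_cancel (by linarith), Real.rpow_one]
      _ ≤ _ := by gcongr
  refine le_trans (ENNReal.ofReal_le_ofReal ?_) (minimaxRisk_ge_of_blocks hα hα1 hc0
    (by rw [hc]; linarith [min_le_left 1 M]) (by rw [hc]; linarith [min_le_right 1 M]) k2 hq0 hqn ?_)
  · have h1 : rate α n ≤ 4 * ((1 / (k : ℝ)) ^ α) ^ 2 := by
      unfold rate
      rw [if_pos hα1]
      calc (n : ℝ) ^ (-(2 * α / (α + 1))) = ((1 / (n : ℝ) ^ (1 / (α + 1))) ^ α) ^ 2 := by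
            rw [one_div, ← Real.rpow_neg hn0.le, ← Real.rpow_mul hn0.le, ← Real.rpow_natCast,
              ← Real.rpow_mul hn0.le]
            congr 1
            push_cast; field_simp
        _ ≤ ((2 * (1 / (k : ℝ))) ^ α) ^ 2 := by
            gcongr
            rw [mul_one_div, div_le_div_iff₀ (by positivity) hk0]
            linarith
        _ = (2 ^ α * (1 / (k : ℝ)) ^ α) ^ 2 := by rw [Real.mul_rpow (by norm_num) (by positivity)]
        _ ≤ (2 ^ (1 : ℝ) * (1 / (k : ℝ)) ^ α) ^ 2 := by gcongr; norm_num
        _ = _ := by rw [Real.rpow_one]; ring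
    calc c ^ 2 / 2048 * rate α n ≤ c ^ 2 / 2048 * (4 * ((1 / (k : ℝ)) ^ α) ^ 2) := by gcongr
      _ = 1 / (n : ℝ) ^ 2 * ((n : ℝ) ^ 2 * (c * (1 / (k : ℝ)) ^ α) ^ 2 / 512) := by
          field_simp; norm_num
      _ ≤ 1 / (n : ℝ) ^ 2 * ((2 * (k * q)) ^ 2 * (c * (1 / (k : ℝ)) ^ α) ^ 2 / 512) := by gcongr
      _ = _ := by ring
  · calc q * (1 / (k : ℝ)) ^ α ≤ n / k * (1 / (k : ℝ)) ^ α := by gcongr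
      _ = n / (k : ℝ) ^ (α + 1) := by
          rw [Real.rpow_add_one hk0.ne', one_div, Real.inv_rpow hk0.le]; field_simp
      _ ≤ 1 := (div_le_one (by positivity)).2 hkα

/-! ### Lower bound `(log n)/n`: waves with unknown frequencies -/

theorem norm_iteratedFDeriv_clm_le_one (L : ℝ × ℝ →L[ℝ] ℝ) (hL : ‖L‖ ≤ 1) {p : ℝ × ℝ}
    (hp : |L p| ≤ 1) (s : ℕ) : ‖iteratedFDeriv ℝ s L p‖ ≤ 1 := by
  rcases s with _ | s
  · simpa using hp
  · rw [← norm_iteratedFDeriv_fderiv]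
    have h : fderiv ℝ L = fun _ => L := funext fun x => L.fderiv
    rw [h]
    rcases s with _ | s
    · simpa using hL
    · rw [iteratedFDeriv_succ_const]
      simp

/-- The derivatives of `ω x y` on the triangle. -/
theorem norm_iteratedFDeriv_mul_le_pow {ω : ℝ} (hω : 1 ≤ ω) {p : ℝ × ℝ} (hp : p ∈ triangle) {s : ℕ}
    (hs : 1 ≤ s) : ‖iteratedFDeriv ℝ s (fun p : ℝ × ℝ => ω * (p.1 * p.2)) p‖ ≤ (2 * ω) ^ s := by
  obtain ⟨h1, h2, h3⟩ := hp
  have hcd : ContDiff ℝ ⊤ (fun p : ℝ × ℝ => p.1 * p.2) := contDiff_fst.mul contDiff_snd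
  have hfst : ∀ i, ‖iteratedFDeriv ℝ i (Prod.fst : ℝ × ℝ → ℝ) p‖ ≤ 1 := fun i =>
    norm_iteratedFDeriv_clm_le_one (ContinuousLinearMap.fst ℝ ℝ ℝ)
      (ContinuousLinearMap.norm_fst_le ℝ ℝ ℝ) (abs_le.2 ⟨by simp; linarith, by simpa using h3⟩) i
  have hsnd : ∀ i, ‖iteratedFDeriv ℝ i (Prod.snd : ℝ × ℝ → ℝ) p‖ ≤ 1 := fun i =>
    norm_iteratedFDeriv_clm_le_one (ContinuousLinearMap.snd ℝ ℝ ℝ)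
      (ContinuousLinearMap.norm_snd_le ℝ ℝ ℝ) (abs_le.2 ⟨by simp; linarith, by simp; linarith⟩) i
  have hmul : ‖iteratedFDeriv ℝ s (fun p : ℝ × ℝ => p.1 * p.2) p‖ ≤ 2 ^ s := by
    refine (norm_iteratedFDeriv_mul_le (N := ⊤) contDiff_fst contDiff_snd p (by simp)).trans ?_
    calc _ ≤ ∑ i ∈ Finset.range (s + 1), (s.choose i : ℝ) * 1 * 1 := by
          gcongr with i
          · exact hfst i
          · exact hsnd _
      _ = 2 ^ s := by
          simp only [mul_one]
          exact_mod_cast Nat.sum_range_choose s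
  have e : (fun p : ℝ × ℝ => ω * (p.1 * p.2)) = fun p : ℝ × ℝ => ω • (p.1 * p.2) := rfl
  rw [e, iteratedFDeriv_const_smul_apply' (hcd.contDiffAt.of_le (by simp)), norm_smul,
    Real.norm_of_nonneg (by linarith), mul_pow]
  calc ω * _ ≤ ω * 2 ^ s := by gcongr
    _ ≤ ω ^ s * 2 ^ s := by gcongr; exact le_self_pow₀ hω (by omega)
    _ = _ := mul_comm _ _

/-- A smooth oscillating graphon. -/
def wave (c a ω : ℝ) (p : ℝ × ℝ) : ℝ := c + a * Real.cos (ω * (p.1 * p.2))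

/-- The Faà di Bruno bound for the `s`-th derivative of the cosine term is `a * s! * (2 * ω) ^ s`,
increasing in `s` as `2 * ω ≥ 1`; hence only the order `⌊α⌋₊ + 1` enters `haω`. -/
theorem wave_mem_graphonClass {α M c a ω : ℝ} (hα : 0 < α) (hc : c ≤ 1 / 4) (hcM : c ≤ M / 4)
    (ha : 0 ≤ a) (hac : a ≤ c) (hω : 1 ≤ ω)
    (haω : a * ((⌊α⌋₊ + 1).factorial * (2 * ω) ^ (⌊α⌋₊ + 1)) ≤ M / 4) :
    wave c a ω ∈ graphonClass α M := by
  have hg : ContDiff ℝ ⊤ (fun p : ℝ × ℝ => ω * (p.1 * p.2)) :=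
    contDiff_const.mul (contDiff_fst.mul contDiff_snd)
  have hh : ContDiff ℝ ⊤ (Real.cos ∘ fun p : ℝ × ℝ => ω * (p.1 * p.2)) := Real.contDiff_cos.comp hg
  have hah : ContDiff ℝ ⊤ (a • (Real.cos ∘ fun p : ℝ × ℝ => ω * (p.1 * p.2))) := hh.const_smul a
  have hw : wave c a ω =
      (fun _ => c) + a • (Real.cos ∘ fun p : ℝ × ℝ => ω * (p.1 * p.2)) := rfl
  have hcos : ∀ p : ℝ × ℝ, |a * Real.cos (ω * (p.1 * p.2))| ≤ a := fun p => by
    rw [abs_mul, abs_of_nonneg ha]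
    exact mul_le_of_le_one_right ha (Real.abs_cos_le_one _)
  refine mem_graphonClass_of_contDiff hα (by linarith) ?_ (fun p => ?_) (fun x y => ?_)
    (fun p => ?_) ?_
  · rw [hw]; exact contDiff_const.add hah
  · have := abs_le.1 (hcos p)
    exact ⟨by unfold wave; linarith, by unfold wave; linarith⟩
  · unfold wave; rw [mul_comm x y]
  · have := abs_le.1 (hcos p)
    unfold wave; linarith
  · intro s hs1 hs p hp
    have h1 := norm_iteratedFDeriv_comp_le (N := ⊤) Real.contDiff_cos hg (n := s) (by simp) p
      (C := 1) (D := 2 * ω)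
      (fun i _ => by
        rw [norm_iteratedFDeriv_eq_norm_iteratedDeriv]
        exact Real.abs_iteratedDeriv_cos_le_one i _)
      (fun i hi _ => norm_iteratedFDeriv_mul_le_pow hω hp hi)
    rw [hw, iteratedFDeriv_add_apply contDiffAt_const
      (hah.contDiffAt.of_le (by simp)),
      iteratedFDeriv_const_of_ne (by omega), Pi.zero_apply, zero_add,
      iteratedFDeriv_const_smul_apply (hh.contDiffAt.of_le (by simp)), norm_smul,
      Real.norm_of_nonneg ha]
    refine le_trans ?_ haω
    gcongr
    refine h1.trans ?_
    rw [mul_one]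
    have hω2 : 1 ≤ 2 * ω := by linarith
    gcongr

/-- The real part of a geometric sum over full periods of a root of unity different from `1`. -/
theorem sum_cos_eq_zero {m N : ℕ} (hm : 0 < m) (hmN : m ∣ N) {q : ℤ} (hq : ¬ (m : ℤ) ∣ q) :
    ∑ j ∈ Finset.range N, Real.cos (2 * Real.pi * q * j / m) = 0 := by
  have hm' : (m : ℂ) ≠ 0 := by exact_mod_cast hm.ne'
  set ζ : ℂ := Complex.exp (2 * Real.pi * q / m * Complex.I) with hζ
  have hζ1 : ζ ≠ 1 := by
    intro h
    obtain ⟨r, hr⟩ := Complex.exp_eq_one_iff.1 h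
    refine hq ⟨r, ?_⟩
    have hpi : (2 * Real.pi * Complex.I : ℂ) ≠ 0 := Complex.two_pi_I_ne_zero
    have h2 : (2 * Real.pi * Complex.I : ℂ) * q = (2 * Real.pi * Complex.I) * (m * r) := by
      field_simp at hr ⊢
      linear_combination hr
    exact_mod_cast mul_left_cancel₀ hpi h2
  have hζN : ζ ^ N = 1 := by
    obtain ⟨r, rfl⟩ := hmN
    rw [hζ, ← Complex.exp_nat_mul]
    refine Complex.exp_eq_one_iff.2 ⟨q * r, ?_⟩
    push_cast
    field_simp
  have hsum : ∑ j ∈ Finset.range N, ζ ^ j = 0 := by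
    rw [geom_sum_eq hζ1, hζN, sub_self, zero_div]
  have hre : ∀ j : ℕ, (ζ ^ j).re = Real.cos (2 * Real.pi * q * j / m) := fun j => by
    rw [hζ, ← Complex.exp_nat_mul, ← Complex.exp_ofReal_mul_I_re]
    congr 2
    push_cast
    ring
  simp_rw [← hre, ← Complex.re_sum, hsum, Complex.zero_re]

theorem sum_cos_nonneg {m N : ℕ} (hm : 0 < m) (hmN : m ∣ N) (q : ℤ) :
    0 ≤ ∑ j ∈ Finset.range N, Real.cos (2 * Real.pi * q * j / m) := by
  by_cases hq : (m : ℤ) ∣ q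
  · obtain ⟨r, rfl⟩ := hq
    refine Finset.sum_nonneg fun j _ => ?_
    have hm' : (m : ℝ) ≠ 0 := by exact_mod_cast hm.ne'
    have : 2 * Real.pi * ((m : ℤ) * r : ℤ) * j / m = ((r * j : ℤ) : ℝ) * (2 * Real.pi) := by
      push_cast; field_simp
    rw [this, Real.cos_int_mul_two_pi]
    exact zero_le_one
  · exact (sum_cos_eq_zero hm hmN hq).ge

/-- Distinct frequencies below `h` are well separated over full periods of length `2 h`. -/
theorem sum_cos_sub_cos_sq_ge {h N : ℕ} (hN : 2 * h ∣ N) {s s' : ℕ} (hs : s < h) (hs' : s' < h)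
    (hne : s ≠ s') :
    (N : ℝ) ≤ ∑ j ∈ Finset.range N, (Real.cos (2 * Real.pi * s * j / (2 * h : ℕ)) -
      Real.cos (2 * Real.pi * s' * j / (2 * h : ℕ))) ^ 2 := by
  have hm : 0 < 2 * h := by omega
  -- After product-to-sum, the constant `1` yields `N`. The frequencies `s ± s'` are not multiples
  -- of `2 * h` and sum to zero; the doubled ones contribute nonnegatively, even for frequency zero.
  have e : ∀ j : ℕ, (Real.cos (2 * Real.pi * s * j / (2 * h : ℕ)) -
      Real.cos (2 * Real.pi * s' * j / (2 * h : ℕ))) ^ 2 =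
      1 + Real.cos (2 * Real.pi * (2 * s : ℤ) * j / (2 * h : ℕ)) / 2 +
      Real.cos (2 * Real.pi * (2 * s' : ℤ) * j / (2 * h : ℕ)) / 2 -
      Real.cos (2 * Real.pi * (s + s' : ℤ) * j / (2 * h : ℕ)) -
      Real.cos (2 * Real.pi * (s - s' : ℤ) * j / (2 * h : ℕ)) := by
    intro j
    set A := 2 * Real.pi * s * j / (2 * h : ℕ) with hA
    set B := 2 * Real.pi * s' * j / (2 * h : ℕ) with hB
    have e1 : 2 * Real.pi * (2 * s : ℤ) * j / (2 * h : ℕ) = 2 * A := by rw [hA]; push_cast; ring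
    have e2 : 2 * Real.pi * (2 * s' : ℤ) * j / (2 * h : ℕ) = 2 * B := by rw [hB]; push_cast; ring
    have e3 : 2 * Real.pi * (s + s' : ℤ) * j / (2 * h : ℕ) = A + B := by
      rw [hA, hB]; push_cast; ring
    have e4 : 2 * Real.pi * (s - s' : ℤ) * j / (2 * h : ℕ) = A - B := by
      rw [hA, hB]; push_cast; ring
    push_cast at e1 e2 e3 e4 ⊢
    rw [e1, e2, e3, e4, Real.cos_two_mul, Real.cos_two_mul, Real.cos_add, Real.cos_sub]
    ring
  simp_rw [e]
  rw [Finset.sum_sub_distrib, Finset.sum_sub_distrib, Finset.sum_add_distrib,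
    Finset.sum_add_distrib, ← Finset.sum_div, ← Finset.sum_div,
    sum_cos_eq_zero hm hN (q := (s + s' : ℤ)) (fun hd => ?_),
    sum_cos_eq_zero hm hN (q := (s - s' : ℤ)) (fun hd => ?_)]
  · have h1 := sum_cos_nonneg hm hN (2 * s : ℤ)
    have h2 := sum_cos_nonneg hm hN (2 * s' : ℤ)
    simp only [Finset.sum_const, Finset.card_range, nsmul_eq_mul, mul_one]
    linarith
  · have := Int.eq_zero_of_abs_lt_dvd hd (by push_cast; rw [abs_lt]; omega)
    omega
  · have := Int.le_of_dvd (by omega) hd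
    omega

/-- The latent positions: the first `N` nodes sit at the unknown positions `z i / m`, the others are
spread over the multiples of `1 / m ^ 2` below `1 / m`. -/
def latentPosition {n N h : ℕ} (m : ℕ) (z : Fin N → Fin h) (i : Fin n) : ℝ :=
  if hi : (i : ℕ) < N then (z ⟨i, hi⟩ : ℕ) / (m : ℝ) else ((i : ℕ) % m : ℕ) / (m : ℝ) ^ 2

theorem latentPosition_mem {n N h m : ℕ} (hm : 0 < m) (hhm : h ≤ m) (z : Fin N → Fin h)
    (i : Fin n) : latentPosition m z i ∈ Set.Icc (0 : ℝ) 1 := by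
  have hm' : (1 : ℝ) ≤ m := by exact_mod_cast hm
  unfold latentPosition
  split_ifs with hi
  · refine ⟨by positivity, div_le_one_of_le₀ ?_ (by positivity)⟩
    exact_mod_cast (z ⟨i, hi⟩).2.le.trans hhm
  · refine ⟨by positivity, div_le_one_of_le₀ ?_ (by positivity)⟩
    have h1 : (((i : ℕ) % m : ℕ) : ℝ) ≤ m := by exact_mod_cast (Nat.mod_lt i hm).le
    nlinarith

theorem cos_latent_mod {m : ℕ} (hm : 0 < m) (s j : ℕ) :
    Real.cos (2 * Real.pi * s * (j % m : ℕ) / m) = Real.cos (2 * Real.pi * s * j / m) := by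
  have hm' : (m : ℝ) ≠ 0 := by exact_mod_cast hm.ne'
  have h1 : (j : ℝ) = m * (j / m : ℕ) + (j % m : ℕ) := by exact_mod_cast (Nat.div_add_mod j m).symm
  have h2 : 2 * Real.pi * s * j / m =
      2 * Real.pi * s * (j % m : ℕ) / m + (s * (j / m : ℕ) : ℕ) * (2 * Real.pi) := by
    rw [h1]; push_cast; field_simp; ring
  rw [h2, Real.cos_add_nat_mul_two_pi]

section WaveFamily

variable {n N h : ℕ} {c a : ℝ}

/-- The phase is an integer multiple of `2π`, so edges among unknown nodes reveal nothing about
their positions. -/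
theorem wave_latent_of_lt {m : ℕ} (hm : 0 < m) (z : Fin N → Fin h) {i j : Fin n} (hi : (i : ℕ) < N)
    (hj : (j : ℕ) < N) :
    wave c a (2 * Real.pi * (m : ℝ) ^ 2) (latentPosition m z i, latentPosition m z j) = c + a := by
  have hm' : (m : ℝ) ≠ 0 := by exact_mod_cast hm.ne'
  unfold wave latentPosition
  rw [dif_pos hi, dif_pos hj]
  have : 2 * Real.pi * (m : ℝ) ^ 2 * (((z ⟨i, hi⟩ : ℕ) : ℝ) / m * (((z ⟨j, hj⟩ : ℕ) : ℝ) / m)) =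
      ((z ⟨i, hi⟩ : ℕ) * (z ⟨j, hj⟩ : ℕ) : ℕ) * (2 * Real.pi) := by
    push_cast; field_simp
  simp only
  rw [this, Real.cos_nat_mul_two_pi, mul_one]

/-- Against the reference nodes, the unknown position becomes the frequency of a cosine in `i`. -/
theorem wave_latent_of_ge {m : ℕ} (hm : 0 < m) (z : Fin N → Fin h) {i j : Fin n} (hi : N ≤ (i : ℕ))
    (hj : (j : ℕ) < N) :
    wave c a (2 * Real.pi * (m : ℝ) ^ 2) (latentPosition m z i, latentPosition m z j) =
      c + a * Real.cos (2 * Real.pi * (z ⟨j, hj⟩ : ℕ) * (i : ℕ) / m) := by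
  have hm' : (m : ℝ) ≠ 0 := by exact_mod_cast hm.ne'
  unfold wave latentPosition
  rw [dif_neg hi.not_gt, dif_pos hj, ← cos_latent_mod hm]
  simp only
  congr 3
  field_simp

/-- The lower bound for smooth graphons, in terms of the number `h` of frequencies and the number `N`
of nodes with unknown positions. -/
theorem minimaxRisk_ge_of_waves {α M : ℝ} (hα : 0 < α) (hc0 : 0 < c) (hc : c ≤ 1 / 4)
    (hcM : c ≤ M / 4) (ha : 0 ≤ a) (hac : a ≤ c / 2) (hh : 0 < h) (hN : 2 * h ∣ N)
    (hNn : 2 * N ≤ n)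
    (haω : a * ((⌊α⌋₊ + 1).factorial *
      (2 * (2 * Real.pi * ((2 * h : ℕ) : ℝ) ^ 2)) ^ (⌊α⌋₊ + 1)) ≤ M / 4) :
    ENNReal.ofReal (1 / (n : ℝ) ^ 2 * (N * (N * a ^ 2 / 4 *
      (1 - √(Real.exp (n * a ^ 2 * (4 / (3 * c))) / h))))) ≤ minimaxRisk n α M := by
  have hm : 0 < 2 * h := by omega
  have hm1 : (1 : ℝ) ≤ (2 * h : ℕ) := by exact_mod_cast hm
  have : NeZero h := ⟨hh.ne'⟩
  set m := 2 * h with hmdef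
  set ω : ℝ := 2 * Real.pi * (m : ℝ) ^ 2 with hω
  have hω1 : 1 ≤ ω := by
    have : 1 ≤ (m : ℝ) ^ 2 := one_le_pow₀ hm1
    nlinarith [Real.pi_gt_three]
  set ξ : (Fin N → Fin h) → Fin n → unitInterval := fun z i =>
    ⟨latentPosition m z i, latentPosition_mem hm (by omega) z i⟩ with hξ
  have hval : ∀ z e, slotTheta (wave c a ω) (ξ z) e =
      wave c a ω (latentPosition m z e.1.1, latentPosition m z e.1.2) := fun _ _ => rfl
  have hrange : ∀ p, |wave c a ω p - c| ≤ a := fun p => by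
    unfold wave
    rw [add_sub_cancel_left, abs_mul, abs_of_nonneg ha]
    exact mul_le_of_le_one_right ha (Real.abs_cos_le_one _)
  -- Only edges from node `t` to reference nodes depend on `z t`.
  set F : Fin N → Finset (EdgeSlot n) := fun t => {e | (e.1.2 : ℕ) = t ∧ N ≤ (e.1.1 : ℕ)} with hF
  have hmemF : ∀ t e, e ∈ F t ↔ (e.1.2 : ℕ) = t ∧ N ≤ (e.1.1 : ℕ) := fun t e => by simp [hF]
  have hcardF : ∀ t, ((F t).card : ℝ) ≤ n := fun t => by
    have h1 : (F t).card ≤ (Finset.univ : Finset (Fin n)).card :=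
      Finset.card_le_card_of_injOn (fun e => e.1.1) (fun e _ => Finset.mem_univ _)
        fun e he e' he' hee => by
          have h2 := (hmemF t e).1 he
          have h3 := (hmemF t e').1 he'
          exact Subtype.ext (Prod.ext hee (Fin.ext (h2.1.trans h3.1.symm)))
    rw [Finset.card_univ, Fintype.card_fin] at h1
    exact_mod_cast h1
  have hvalF : ∀ z t e, e ∈ F t → slotTheta (wave c a ω) (ξ z) e =
      c + a * Real.cos (2 * Real.pi * (z t : ℕ) * (e.1.1 : ℕ) / m) := fun z t e he => by
    obtain ⟨h1, h2⟩ := (hmemF t e).1 he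
    have h3 : (e.1.2 : ℕ) < N := h1 ▸ t.2
    have h4 : (⟨e.1.2, h3⟩ : Fin N) = t := Fin.ext h1
    rw [hval, wave_latent_of_ge hm z h2 h3, h4]
  have hmain := minimaxRisk_ge (n := n) (α := α) (M := M) (fun _ => wave c a ω) ξ
    (fun z => wave_mem_graphonClass hα hc hcM ha (by linarith) hω1 haω)
    (c := c) (b := n * a ^ 2 * (4 / (3 * c))) (D := N * a ^ 2) ?_ ⟨hc0, by linarith⟩ F ?_ ?_ ?_
    (by positivity) ?_
  · rwa [Fintype.card_fin, Fintype.card_fin] at hmain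
  · intro z e
    have := abs_le.1 (hrange (latentPosition m z e.1.1, latentPosition m z e.1.2))
    rw [hval]
    exact ⟨by linarith, by linarith⟩
  · intro t t' htt
    refine Finset.disjoint_left.2 fun e he he' => htt (Fin.ext ?_)
    exact ((hmemF t e).1 he).1.symm.trans ((hmemF t' e).1 he').1
  · intro z t s e he
    rw [hval, hval]
    have hlt : (e.1.2 : ℕ) < e.1.1 := e.2
    rcases lt_or_ge (e.1.1 : ℕ) N with h1 | h1
    · rw [wave_latent_of_lt hm _ h1 (hlt.trans h1), wave_latent_of_lt hm _ h1 (hlt.trans h1)]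
    · have hp : ∀ i : Fin n, (i : ℕ) ≠ t →
          latentPosition m (Function.update z t s) i = latentPosition m z i := fun i hi => by
        unfold latentPosition
        split_ifs with hiN
        · rw [Function.update_of_ne fun h => hi (congrArg Fin.val h)]
        · rfl
      have h2 : (e.1.2 : ℕ) ≠ t := fun h => he ((hmemF t e).2 ⟨h, h1⟩)
      have h3 : (e.1.1 : ℕ) ≠ t := by have := t.2; omega
      rw [hp _ h2, hp _ h3]
  · intro z t
    calc ∑ e ∈ F t, (slotTheta (wave c a ω) (ξ z) e - c) ^ 2 / (c * (1 - c))
        ≤ ∑ _e ∈ F t, a ^ 2 / (c * (3 / 4)) := by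
          refine Finset.sum_le_sum fun e he => ?_
          have : (slotTheta (wave c a ω) (ξ z) e - c) ^ 2 ≤ a ^ 2 :=
            sq_le_sq.2 ((hrange _).trans (le_abs_self a))
          gcongr
          linarith
      _ ≤ n * (a ^ 2 / (c * (3 / 4))) := by
          rw [Finset.sum_const, nsmul_eq_mul]
          gcongr
          exact_mod_cast hcardF t
      _ = _ := by field_simp
  · intro z t s s' hs
    -- The reduction `j % N` only makes `σ` total; on `range N` it is `j`. As `m ∣ N`, the shift by
    -- `N` leaves the phase unchanged.
    have hslot : ∀ j, N + j % N < n ∧ (t : ℕ) < n := fun j => by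
      have := Nat.mod_lt j (t.2.trans_le' (Nat.zero_le _))
      have := t.2
      omega
    set σ : ℕ → EdgeSlot n := fun j => ⟨(⟨N + j % N, (hslot j).1⟩, ⟨t, (hslot j).2⟩),
      show (t : ℕ) < N + j % N by have := t.2; omega⟩ with hσ
    have hσF : ∀ j, σ j ∈ F t := fun j => (hmemF t _).2 ⟨rfl, Nat.le_add_right _ _⟩
    have hσinj : Set.InjOn σ (Finset.range N) := fun j hj j' hj' hjj => by
      have h1 : N + j % N = N + j' % N := congrArg (fun e : EdgeSlot n => (e.1.1 : ℕ)) hjj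
      rw [Nat.mod_eq_of_lt (by simpa using hj), Nat.mod_eq_of_lt (by simpa using hj')] at h1
      omega
    calc (N : ℝ) * a ^ 2
        ≤ (∑ j ∈ Finset.range N, (Real.cos (2 * Real.pi * (s : ℕ) * j / m) -
            Real.cos (2 * Real.pi * (s' : ℕ) * j / m)) ^ 2) * a ^ 2 := by
          gcongr
          exact sum_cos_sub_cos_sq_ge hN s.2 s'.2 fun h => hs (Fin.ext h)
      _ = ∑ j ∈ Finset.range N,
          (slotTheta (wave c a ω) (ξ (Function.update z t s)) (σ j) -
            slotTheta (wave c a ω) (ξ (Function.update z t s')) (σ j)) ^ 2 := by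
          rw [Finset.sum_mul]
          refine Finset.sum_congr rfl fun j hj => ?_
          have hmod : (N + j % N) % m = j % m := by
            rw [Nat.mod_eq_of_lt (Finset.mem_range.1 hj)]
            obtain ⟨r, hr⟩ := hN
            rw [hr, Nat.mul_add_mod]
          rw [hvalF _ t _ (hσF j), hvalF _ t _ (hσF j), Function.update_self, Function.update_self,
            ← cos_latent_mod hm _ (σ j).1.1, ← cos_latent_mod hm (s' : ℕ) (σ j).1.1,
            ← cos_latent_mod hm _ j, ← cos_latent_mod hm (s' : ℕ) j]
          simp only [hσ, hmod]
          ring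
      _ = ∑ e ∈ (Finset.range N).image σ,
          (slotTheta (wave c a ω) (ξ (Function.update z t s)) e -
            slotTheta (wave c a ω) (ξ (Function.update z t s')) e) ^ 2 :=
          (Finset.sum_image (f := fun e =>
            (slotTheta (wave c a ω) (ξ (Function.update z t s)) e -
            slotTheta (wave c a ω) (ξ (Function.update z t s')) e) ^ 2) hσinj).symm
      _ ≤ _ := by
          refine Finset.sum_le_sum_of_subset_of_nonneg (fun e he => ?_) fun e _ _ => sq_nonneg _
          obtain ⟨j, -, rfl⟩ := Finset.mem_image.1 he
          exact hσF j

end WaveFamily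

/-- A crude lower bound, from two constant graphons, that settles small `n`. -/
theorem minimaxRisk_ge_of_const {α M c : ℝ} (hα : 0 < α) (hc0 : 0 < c) (hc : c ≤ 1 / 4)
    (hcM : c ≤ M / 4) {n : ℕ} (hn : 2 ≤ n) :
    ENNReal.ofReal (c ^ 2 / (32 * (n : ℝ) ^ 4)) ≤ minimaxRisk n α M := by
  have hn0 : (0 : ℝ) < n := by positivity
  have hn1 : (1 : ℝ) ≤ n := by exact_mod_cast (by omega : 1 ≤ n)
  have hcn : c / n ≤ c := div_le_self hc0.le hn1
  have hcn0 : 0 ≤ c / n := by positivity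
  -- The perturbation `c / n` keeps the chi-square information bounded over all of the at most `n ^
  -- 2` edges.
  set v : (Unit → Bool) → ℝ := fun z => if z () = true then c / n else 0 with hv
  have hv0 : ∀ z, 0 ≤ v z := fun z => by simp only [hv]; split_ifs <;> positivity
  have hv1 : ∀ z, v z ≤ c / n := fun z => by simp only [hv]; split_ifs <;> linarith
  have hval : ∀ z e, slotTheta (n := n) (fun _ => c + v z) (fun _ => 0) e = c + v z :=
    fun _ _ => rfl
  have hcard : Fintype.card (EdgeSlot n) ≤ (n : ℝ) ^ 2 := by
    have := Fintype.card_subtype_le fun p : Fin n × Fin n => p.2 < p.1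
    rw [Fintype.card_prod, Fintype.card_fin] at this
    rw [sq]
    exact_mod_cast this
  have hcard1 : (1 : ℝ) ≤ Fintype.card (EdgeSlot n) := by
    have := card_edgeSlot_ge hn
    have hn2 : (2 : ℝ) ≤ n := by exact_mod_cast hn
    nlinarith
  have hmain := minimaxRisk_ge (n := n) (α := α) (M := M) (T := Unit) (ι := Bool)
    (fun z _ => c + v z) (fun _ _ => 0) (fun z => ?_) ?_ (c := c) ⟨hc0, by linarith⟩
    (fun _ => Finset.univ) (fun t t' h => absurd rfl h)
    (fun z t s e he => absurd (Finset.mem_univ e) he) (b := 1 / 3) (D := (c / n) ^ 2) ?_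
    (by positivity) ?_
  · refine le_trans (ENNReal.ofReal_le_ofReal ?_) hmain
    rw [Fintype.card_bool, Fintype.card_unit]
    calc c ^ 2 / (32 * (n : ℝ) ^ 4) =
          1 / (n : ℝ) ^ 2 * ((1 : ℕ) * ((c / n) ^ 2 / 4 * (1 / 8))) := by
          field_simp; norm_num
      _ ≤ _ := by
          gcongr
          exact_mod_cast one_eighth_le_one_sub_sqrt le_rfl
  · refine mem_graphonClass_of_contDiff hα (by linarith) contDiff_const
      (fun p => ⟨by linarith [hv0 z], by linarith [hv1 z]⟩) (fun _ _ => rfl)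
      (fun p => by linarith [hv1 z]) fun s hs _ p _ => ?_
    rw [iteratedFDeriv_const_of_ne (by omega)]
    simp only [Pi.zero_apply, norm_zero]
    linarith
  · intro z e
    rw [hval]
    exact ⟨by linarith [hv0 z], by linarith [hv1 z]⟩
  · intro z t
    calc ∑ e, (slotTheta (n := n) (fun _ => c + v z) (fun _ => 0) e - c) ^ 2 / (c * (1 - c))
        ≤ ∑ _e : EdgeSlot n, (c / n) ^ 2 / (c * (3 / 4)) := by
          refine Finset.sum_le_sum fun e _ => ?_
          rw [hval, add_sub_cancel_left]
          gcongr
          · exact hv1 z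
          · linarith
      _ ≤ (n : ℝ) ^ 2 * ((c / n) ^ 2 / (c * (3 / 4))) := by
          rw [Finset.sum_const, Finset.card_univ, nsmul_eq_mul]
          gcongr
      _ = 4 / 3 * c := by field_simp
      _ ≤ 1 / 3 := by linarith
  · intro z t s s' hs
    calc (c / n) ^ 2 ≤ Fintype.card (EdgeSlot n) * (c / n) ^ 2 :=
          le_mul_of_one_le_left (sq_nonneg _) hcard1
      _ = ∑ _e : EdgeSlot n, (c / n) ^ 2 := by
          rw [Finset.sum_const, Finset.card_univ, nsmul_eq_mul]
      _ ≤ _ := by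
          refine Finset.sum_le_sum fun e _ => ?_
          rw [hval, hval]
          simp only [hv, Function.update_self]
          rcases s with _ | _ <;> rcases s' with _ | _
          · exact absurd rfl hs
          · simp
          · simp
          · exact absurd rfl hs

/-- The lower bound `log n / n` holds for every smoothness `α`, for large `n`. -/
theorem exists_log_div_le_minimaxRisk {α M : ℝ} (hα : 0 < α) (hM : 0 < M) :
    ∃ C : ℝ, 0 < C ∧ ∃ n₀ : ℕ, ∀ n : ℕ, 2 ≤ n → n₀ ≤ n →
      ENNReal.ofReal (C * (Real.log n / n)) ≤ minimaxRisk n α M := by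
  set c : ℝ := min 1 M / 4 with hc
  have hc0 : 0 < c := div_pos (lt_min one_pos hM) (by norm_num)
  have hc1 : c ≤ 1 / 4 := by rw [hc]; linarith [min_le_left 1 M]
  have hcM : c ≤ M / 4 := by rw [hc]; linarith [min_le_right 1 M]
  set r := ⌊α⌋₊ + 1 with hr
  have hr1 : (1 : ℝ) ≤ r := by rw [hr]; push_cast; linarith [(Nat.cast_nonneg _ : (0 : ℝ) ≤ ⌊α⌋₊)]
  -- Since `ω` is of order `h² ≈ n^(2γ)`, the factor `ω ^ r` in the derivative bound is of order
  -- `n^(1/4)`, which `a ≤ 2 κ n^(-1/4)` cancels.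
  set γ : ℝ := 1 / (8 * r) with hγ
  have hγ0 : 0 < γ := by positivity
  have hγ1 : γ ≤ 1 / 8 := by
    rw [hγ]; gcongr; linarith
  set A : ℝ := r.factorial * (64 * Real.pi) ^ r with hA
  have hA0 : 0 < A := by positivity
  -- The first entry keeps the information of a node below `(γ / 2) log n`, half of the log-number
  -- of frequencies; the second keeps the wave in the class.
  set κ : ℝ := min (c * γ) (M / (8 * A)) with hκ
  have hκ0 : 0 < κ := lt_min (by positivity) (by positivity)
  have hκ1 : κ ≤ c * γ := min_le_left _ _
  have hκ2 : κ * A ≤ M / 8 := by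
    have : κ ≤ M / (8 * A) := min_le_right _ _
    calc κ * A ≤ M / (8 * A) * A := by gcongr
      _ = M / 8 := by field_simp
  set η : ℝ := 1 - √((2 : ℝ) ^ (-(γ / 2))) with hη
  have hη0 : 0 < η := by
    have h1 : (2 : ℝ) ^ (-(γ / 2)) < 1 := Real.rpow_lt_one_of_one_lt_of_neg (by norm_num) (by linarith)
    have : √((2 : ℝ) ^ (-(γ / 2))) < 1 := (Real.sqrt_lt' one_pos).2 (by simpa using h1)
    linarith
  have htend := (tendsto_rpow_atTop (y := 1 - γ) (by linarith)).comp tendsto_natCast_atTop_atTop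
  obtain ⟨n₀, hn₀⟩ := Filter.eventually_atTop.1 (htend.eventually_ge_atTop 8)
  refine ⟨κ ^ 2 * η / 64, by positivity, n₀, fun n hn hnn => ?_⟩
  have hn0 : (0 : ℝ) < n := by positivity
  have hn1 : (1 : ℝ) < n := by exact_mod_cast hn
  have hlog0 : 0 < Real.log n := Real.log_pos hn1
  have hng : (1 : ℝ) < (n : ℝ) ^ γ := Real.one_lt_rpow hn1 hγ0
  set h := ⌈(n : ℝ) ^ γ⌉₊ with hh
  have hh2 : (n : ℝ) ^ γ ≤ h := Nat.le_ceil _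
  have hh3 : (h : ℝ) ≤ 2 * (n : ℝ) ^ γ := by
    linarith [Nat.ceil_lt_add_one (zero_le_one.trans hng.le)]
  have hh0 : 0 < h := Nat.ceil_pos.2 (by linarith)
  have hhn : 4 * h ≤ n := by
    have h1 : (8 : ℝ) ≤ (n : ℝ) ^ (1 - γ) := hn₀ n hnn
    have h2 : (n : ℝ) ^ (1 - γ) * (n : ℝ) ^ γ = n := by
      rw [← Real.rpow_add hn0]; simp
    have h3 : 4 * (h : ℝ) ≤ n := by nlinarith
    exact_mod_cast h3
  -- Makes `N = 2 * h * x` a multiple of the period with `2 * N ≤ n ≤ 4 * N`.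
  set x := n / (4 * h) with hx
  have hx1 : 1 ≤ x := Nat.div_pos hhn (by omega)
  have hxn : 4 * h * x ≤ n := Nat.mul_div_le n _
  have hnx : n < 4 * h * (x + 1) := Nat.lt_mul_div_succ n (by omega)
  set N := 2 * h * x with hN
  have hNn : 2 * N ≤ n := by rw [hN]; linarith
  have hnN : (n : ℝ) ≤ 4 * N := by
    have h1 : 4 * h * (x + 1) ≤ 4 * h * (x + x) := Nat.mul_le_mul_left _ (by omega)
    have h2 : 4 * h * (x + x) = 4 * N := by rw [hN]; ring
    have : n ≤ 4 * N := by omega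
    exact_mod_cast this
  set a : ℝ := κ * √(Real.log n / n) with ha
  have ha0 : 0 ≤ a := by positivity
  have ha2 : a ^ 2 = κ ^ 2 * (Real.log n / n) := by
    rw [ha, mul_pow, Real.sq_sqrt (by positivity)]
  have hsqrt : √(Real.log n / n) ≤ 2 * (n : ℝ) ^ (-(1 / 4) : ℝ) := by
    refine Real.sqrt_le_iff.2 ⟨by positivity, ?_⟩
    have h1 := Real.log_le_rpow_div hn0.le (by norm_num : (0 : ℝ) < 1 / 2)
    calc Real.log n / n ≤ ((n : ℝ) ^ (1 / 2 : ℝ) / (1 / 2)) / n := by gcongr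
      _ = 2 * ((n : ℝ) ^ (1 / 2 : ℝ) * (n : ℝ) ^ (-1 : ℝ)) := by rw [Real.rpow_neg_one]; ring
      _ = 2 * ((n : ℝ) ^ (-(1 / 4) : ℝ)) ^ 2 := by
          rw [← Real.rpow_add hn0, ← Real.rpow_natCast, ← Real.rpow_mul hn0.le]
          norm_num
      _ ≤ (2 * (n : ℝ) ^ (-(1 / 4) : ℝ)) ^ 2 := by
          rw [mul_pow]; gcongr; norm_num
  have hquarter : (n : ℝ) ^ (-(1 / 4) : ℝ) ≤ 1 :=
    Real.rpow_le_one_of_one_le_of_nonpos hn1.le (by norm_num)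
  have hac : a ≤ c / 2 := by
    calc a ≤ c * γ * (2 * 1) := by rw [ha]; gcongr; exact hsqrt.trans (by gcongr)
      _ ≤ c * (1 / 8) * (2 * 1) := by gcongr
      _ ≤ c / 2 := by linarith
  refine le_trans (ENNReal.ofReal_le_ofReal ?_) (minimaxRisk_ge_of_waves (N := N) (h := h) hα hc0 hc1
    hcM ha0 hac hh0 ⟨x, rfl⟩ hNn ?_)
  · have hexp : Real.exp (n * a ^ 2 * (4 / (3 * c))) / h ≤ (2 : ℝ) ^ (-(γ / 2)) := by
      have h1 : n * a ^ 2 * (4 / (3 * c)) ≤ Real.log n * (γ / 2) := by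
        have h3 : κ ^ 2 * (4 / (3 * c)) ≤ γ / 2 := by
          calc κ ^ 2 * (4 / (3 * c)) ≤ (c * γ) ^ 2 * (4 / (3 * c)) := by gcongr
            _ = c * γ * 4 / 3 * γ := by field_simp
            _ ≤ (1 / 4) * (1 / 8) * 4 / 3 * γ := by gcongr
            _ ≤ γ / 2 := by linarith
        calc n * a ^ 2 * (4 / (3 * c)) = Real.log n * (κ ^ 2 * (4 / (3 * c))) := by
              rw [ha2]; field_simp
          _ ≤ _ := by gcongr
      calc Real.exp (n * a ^ 2 * (4 / (3 * c))) / h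
          ≤ Real.exp (Real.log n * (γ / 2)) / (n : ℝ) ^ γ := by gcongr
        _ = (n : ℝ) ^ (-(γ / 2)) := by
            rw [← Real.rpow_def_of_pos hn0, ← Real.rpow_sub hn0]; ring_nf
        _ ≤ (2 : ℝ) ^ (-(γ / 2)) :=
            Real.rpow_le_rpow_of_nonpos (by norm_num) (by exact_mod_cast hn) (by linarith)
    have hη1 : η ≤ 1 - √(Real.exp (n * a ^ 2 * (4 / (3 * c))) / h) := by
      rw [hη]; gcongr
    calc κ ^ 2 * η / 64 * (Real.log n / n)
        = 1 / (n : ℝ) ^ 2 * ((n : ℝ) ^ 2 * a ^ 2 * η / 64) := by rw [ha2]; field_simp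
      _ ≤ 1 / (n : ℝ) ^ 2 * ((4 * N) ^ 2 * a ^ 2 * η / 64) := by gcongr
      _ = 1 / (n : ℝ) ^ 2 * (N * (N * a ^ 2 / 4 * η)) := by ring
      _ ≤ _ := by gcongr
  · have h1 : 2 * (2 * Real.pi * ((2 * h : ℕ) : ℝ) ^ 2) ≤ 64 * Real.pi * (n : ℝ) ^ (2 * γ) := by
      calc 2 * (2 * Real.pi * ((2 * h : ℕ) : ℝ) ^ 2) = 16 * Real.pi * (h : ℝ) ^ 2 := by
            push_cast; ring
        _ ≤ 16 * Real.pi * (2 * (n : ℝ) ^ γ) ^ 2 := by gcongr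
        _ = 64 * Real.pi * ((n : ℝ) ^ γ) ^ 2 := by ring
        _ = _ := by
            rw [← Real.rpow_natCast, ← Real.rpow_mul hn0.le]
            congr 2
            push_cast; ring
    have h2 : ((n : ℝ) ^ (2 * γ)) ^ r = (n : ℝ) ^ (1 / 4 : ℝ) := by
      rw [← Real.rpow_natCast, ← Real.rpow_mul hn0.le]
      congr 1
      rw [hγ]; field_simp; norm_num
    calc a * (r.factorial * (2 * (2 * Real.pi * ((2 * h : ℕ) : ℝ) ^ 2)) ^ r)
        ≤ κ * (2 * (n : ℝ) ^ (-(1 / 4) : ℝ)) *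
          (r.factorial * (64 * Real.pi * (n : ℝ) ^ (2 * γ)) ^ r) := by
          rw [ha]; gcongr
      _ = 2 * (κ * A) * ((n : ℝ) ^ (-(1 / 4) : ℝ) * (n : ℝ) ^ (1 / 4 : ℝ)) := by
          rw [mul_pow, h2, hA]; ring
      _ = 2 * (κ * A) := by
          rw [← Real.rpow_add hn0]; simp
      _ ≤ M / 4 := by linarith

/-! ### Assembly of the two bounds -/

theorem minimaxRisk_lower {α M : ℝ} (hα : 0 < α) (hM : 0 < M) :
    ∃ C : ℝ, 0 < C ∧ ∀ n : ℕ, 2 ≤ n → ENNReal.ofReal (C * rate α n) ≤ minimaxRisk n α M := by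
  rcases lt_or_ge α 1 with hα1 | hα1
  · exact minimaxRisk_lower_of_lt_one hα hα1 hM
  obtain ⟨C, hC, n₀, hn₀⟩ := exists_log_div_le_minimaxRisk hα hM
  set c : ℝ := min 1 M / 4 with hc
  have hc0 : 0 < c := div_pos (lt_min one_pos hM) (by norm_num)
  -- For `n < n₀` the rate is at most `1`, and the crude bound from constant graphons suffices.
  refine ⟨min C (c ^ 2 / (32 * ((n₀ : ℝ) + 1) ^ 4)), lt_min hC (by positivity), fun n hn => ?_⟩
  have hn0 : (0 : ℝ) < n := by positivity
  have hn1 : (1 : ℝ) ≤ n := by exact_mod_cast (by omega : 1 ≤ n)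
  have hlog : 0 ≤ Real.log n / n := div_nonneg (Real.log_nonneg hn1) hn0.le
  unfold rate
  rw [if_neg hα1.not_gt]
  rcases le_or_gt n₀ n with h | h
  · refine le_trans (ENNReal.ofReal_le_ofReal ?_) (hn₀ n hn h)
    gcongr
    exact min_le_left _ _
  · refine le_trans (ENNReal.ofReal_le_ofReal ?_) (minimaxRisk_ge_of_const hα hc0
      (by rw [hc]; linarith [min_le_left 1 M]) (by rw [hc]; linarith [min_le_right 1 M]) hn)
    have h1 : Real.log n / n ≤ 1 := by
      rw [div_le_one hn0]
      linarith [Real.log_le_sub_one_of_pos hn0]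
    have h2 : (n : ℝ) ≤ n₀ + 1 := by exact_mod_cast (by omega : n ≤ n₀ + 1)
    calc _ ≤ c ^ 2 / (32 * ((n₀ : ℝ) + 1) ^ 4) * 1 := by
          gcongr
          exact min_le_right _ _
      _ ≤ c ^ 2 / (32 * (n : ℝ) ^ 4) := by
          rw [mul_one]
          gcongr

theorem rate_nonneg (α : ℝ) (n : ℕ) : 0 ≤ rate α n := by
  unfold rate
  split_ifs
  · positivity
  · exact div_nonneg (Real.log_natCast_nonneg n) n.cast_nonneg

end

end Graphon

theorem theorem1p2 (α M : ℝ) (hα : 0 < α) (hM : 0 < M) :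
    ∃ C : ℝ, 0 < C ∧ ∀ n : ℕ, 2 ≤ n →
      ENNReal.ofReal (C⁻¹ * Graphon.rate α n) ≤ Graphon.minimaxRisk n α M ∧
      Graphon.minimaxRisk n α M ≤ ENNReal.ofReal (C * Graphon.rate α n) := by
  obtain ⟨C₁, hC₁, h₁⟩ := Graphon.minimaxRisk_lower hα hM
  obtain ⟨C₂, hC₂, h₂⟩ := Graphon.minimaxRisk_upper hα hM.le
  refine ⟨max C₁⁻¹ C₂, lt_max_of_lt_right hC₂, fun n hn => ⟨?_, ?_⟩⟩
  · refine le_trans (ENNReal.ofReal_le_ofReal ?_) (h₁ n hn)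
    refine mul_le_mul_of_nonneg_right ?_ (Graphon.rate_nonneg α n)
    exact inv_le_of_inv_le₀ hC₁ (le_max_left _ _)
  · refine le_trans (h₂ n hn) (ENNReal.ofReal_le_ofReal ?_)
    exact mul_le_mul_of_nonneg_right (le_max_right _ _) (Graphon.rate_nonneg α n)
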